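/- **Setting.** There are $n\ge1$ agents $i\in[n]=\{1,\dots,n\}$ and times $t\in\mathbb N_+$. All norms are Euclidean (spectral for matrices), and $[\cdot]_+$ is the componentwise positive part, i.e. the projection onto the nonnegative orthant. Let $R,F_1,F_2>0$, $w\in(0,1)$, an integer $B\ge1$, $m_1,\dots,m_n\in\mathbb N$, $\kappa\in(0,1)$ and $\theta>0$ be given. *Problem.* $\mathbb X\subseteq\mathbb R^p$ is closed and convex with $\|x\|\le R$ on $\mathbb X$. The functions $f_{i,t}:\mathbb X\to\mathbb R$ and (componentwise) $g_{i,t}:\mathbb X\to\mathbb R^{m_i}$ are convex, with $|f_{i,t}(x)-f_{i,t}(y)|\le F_1$ and $\|g_{i,t}(x)\|\le F_1$ for $x,y\in\mathbb X$. At every $x\in\mathbb X$ there are a subgradient $\partial f_{i,t}(x)\in\mathbb R^p$ of $f_{i,t}$ on $\mathbb X$ and a $p\times m_i$ matrix $\partial g_{i,t}(x)$, whose columns are subgradients on $\mathbb X$ of the components of $g_{i,t}$, both of norm at most $F_2$. Put $f_t=\frac1n\sum_j f_{j,t}$ and $g_t=\mathrm{col}(g_{1,t},\dots,g_{n,t})$.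 *Network.* $\mathcal G_t=([n],\mathcal E_t)$ are directed graphs and $W_t\in\mathbb R^{n\times n}$ are doubly stochastic matrices with $[W_t]_{ij}>0$ if $(j,i)\in\mathcal E_t$ or $i=j$, $[W_t]_{ij}=0$ otherwise, and $[W_t]_{ij}\ge w$ whenever $[W_t]_{ij}>0$. For every $t\in\mathbb N_+$ the graph $([n],\bigcup_{l=0}^{B-1}\mathcal E_{t+l})$ is strongly connected. *Algorithm.* Let $\tau_t=t^{-\theta}$, $\Psi_t=\sum_{s=1}^t\tau_s$, $\alpha_t=\sqrt{\Psi_t/t}$, $\beta_t=t^{-\kappa}$, $\gamma_t=t^{-(1-\kappa)}$. Start from any $x_{i,1}\in\mathbb X$, $\hat x_{i,1}=x_{i,1}$, $q_{i,1}=0$. For $t\ge1$ each agent observes $[g_{i,t}(x_{i,t})]_+$, a subgradient $u_{i,t}$ of $f_{i,t}$ at $x_{i,t}$, and a $p\times m_i$ matrix $D_{i,t}$ whose columns are subgradients at $x_{i,t}$ of the components of $[g_{i,t}]_+$, with $\|u_{i,t}\|,\|D_{i,t}\|\le F_2$, and sets $$z_{i,t+1}=\sum_{j=1}^n[W_t]_{ij}\hat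 x_{j,t},\qquad \omega_{i,t+1}=u_{i,t}+D_{i,t}q_{i,t},\qquad x_{i,t+1}=\mathcal P_{\mathbb X}(z_{i,t+1}-\alpha_{t+1}\omega_{i,t+1}),$$ $$q_{i,t+1}=\Big[(1-\beta_{t+1}\gamma_{t+1})q_{i,t}+\gamma_{t+1}\big([g_{i,t}(x_{i,t})]_++D_{i,t}^{T}(x_{i,t+1}-x_{i,t})\big)\Big]_+,$$ where $\mathcal P_{\mathbb X}$ is the Euclidean projection onto $\mathbb X$; and $\hat x_{i,t+1}=x_{i,t+1}$ if $\|x_{i,t+1}-\hat x_{i,t}\|\ge\tau_{t+1}$, $\hat x_{i,t+1}=\hat x_{i,t}$ otherwise. *Performance measures.* For $T\in\mathbb N_+$ let $\mathcal X_T$ be the set of sequences $y_{[T]}=(y_1,\dots,y_T)$ in $\mathbb X$ with $g_t(y_t)\le0$ for all $t\le T$, and put $$\mathrm{Reg}_T(y)=\frac1n\sum_{i=1}^n\sum_{t=1}^Tf_t(x_{i,t})-\sum_{t=1}^Tf_t(y_t),\quad \mathrm{CCV}_T=\frac1n\sum_{i=1}^n\sum_{t=1}^T\big\|[g_t(x_{i,t})]_+\big\|,\quad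 P_T=\sum_{t=1}^{T-1}\|y_{t+1}-y_t\|.$$ **Claim.** There is a constant $C>0$, depending only on $n,(m_i),R,F_1,F_2,w,B,\kappa,\theta$, such that for all data as above, all sequences generated by the algorithm and all $T\in\mathbb N_+$ the following holds. (a) For every $y_{[T]}\in\mathcal X_T$, $$\mathrm{Reg}_T(y)\le\begin{cases}C\big(T^{\max\{\kappa,1-\theta/2\}}+T^{\theta/2}P_T\big)&\text{if }0<\theta<1,\\ C\big(T^{\kappa}+\sqrt{T\log T}+\sqrt{T/\log T}\,P_T\big)&\text{if }\theta=1,\\ C\big(T^{\max\{\kappa,1/2\}}+T^{1/2}P_T\big)&\text{if }\theta>1\end{cases}$$ (for $T=1$ one has $P_T=0$, and the terms with $P_T$ are read as $0$). (b) If some constant sequence $(x,\dots,x)$ lies in $\mathcal X_T$, then $$\mathrm{CCV}_T\le\begin{cases}C\,T^{\max\{1-\kappa/2,\,1-\theta/4\}}&\text{if }0<\theta<1,\\ C\big(T^{1-\kappa/2}+(T^3\log T)^{1/4}\big)&\text{if }\theta=1,\\ C\,T^{\max\{1-\kappa/2,\,3/4\}}&\text{if }\theta>1.\end{cases}$$ 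-/

import Mathlib

namespace EventTriggered

noncomputable section

/-- `ℝᵖ` with the Euclidean norm. -/
abbrev Vec (p : ℕ) : Type := EuclideanSpace ℝ (Fin p)

/-- `x` is the Euclidean projection of `v` onto `K`: a point of `K` at minimal distance from `v`. -/
def IsProj {E : Type*} [NormedAddCommGroup E] (K : Set E) (v x : E) : Prop :=
  x ∈ K ∧ ∀ y ∈ K, ‖v - x‖ ≤ ‖v - y‖

/-- `[v]₊`, the componentwise positive part. -/
def posVec {ι : Type*} (v : EuclideanSpace ℝ ι) : EuclideanSpace ℝ ι :=
  WithLp.toLp 2 (fun k => max (v k) 0)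

/-- `[v]₊` is the projection of `v` onto the nonnegative orthant. -/
theorem isProj_posVec {ι : Type*} [Fintype ι] (v : EuclideanSpace ℝ ι) :
    IsProj {u : EuclideanSpace ℝ ι | ∀ k, 0 ≤ u k} v (posVec v) := by
  refine ⟨fun k => le_max_right _ _, fun y hy => ?_⟩
  rw [EuclideanSpace.norm_eq, EuclideanSpace.norm_eq]
  refine Real.sqrt_le_sqrt (Finset.sum_le_sum fun k _ => ?_)
  have h0 : 0 ≤ y k := hy k
  simp only [PiLp.sub_apply, posVec, Real.norm_eq_abs, sq_abs]
  rcases le_total (v k) 0 with h | h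
  · rw [max_eq_right h]; nlinarith
  · rw [max_eq_left h]; nlinarith [sq_nonneg (v k - y k)]

/-- `v` is a subgradient at `x` of the real-valued function `f` on `X`. -/
def IsSubgradientOn {p : ℕ} (X : Set (Vec p)) (f : Vec p → ℝ) (x v : Vec p) : Prop :=
  ∀ y ∈ X, f x + inner ℝ v (y - x) ≤ f y

/-- `D : ℝᵖ → ℝᵏ` is the transpose `(∂g(x))ᵀ` of a `p × k` matrix `∂g(x)` whose `j`-th column is
a subgradient at `x` of the `j`-th component of `g` on `X`. The matrix itself acts as
`ContinuousLinearMap.adjoint D`, and `‖D‖` is its spectral norm. -/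
def IsVecSubgradientOn {p k : ℕ} (X : Set (Vec p)) (g : Vec p → Vec k) (x : Vec p)
    (D : Vec p →L[ℝ] Vec k) : Prop :=
  ∀ j : Fin k, ∀ y ∈ X, g x j + D (y - x) j ≤ g y j

/-- Assumptions on the decision set, the local losses `f i t` and the local constraint functions
`g i t` (`t ≥ 1`). Only the values on `X` matter. -/
structure ConvexProblem {n p : ℕ} {m : Fin n → ℕ} (X : Set (Vec p)) (f : Fin n → ℕ → Vec p → ℝ)
    (g : (i : Fin n) → ℕ → Vec p → Vec (m i)) (R F₁ F₂ : ℝ) : Prop where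
  convex : Convex ℝ X
  closed : IsClosed X
  bounded : ∀ x ∈ X, ‖x‖ ≤ R
  convex_loss : ∀ i, ∀ t ≥ 1, ConvexOn ℝ X (f i t)
  convex_constraint : ∀ i, ∀ t ≥ 1, ∀ k, ConvexOn ℝ X (fun x => g i t x k)
  loss_variation : ∀ i, ∀ t ≥ 1, ∀ x ∈ X, ∀ y ∈ X, |f i t x - f i t y| ≤ F₁
  constraint_bound : ∀ i, ∀ t ≥ 1, ∀ x ∈ X, ‖g i t x‖ ≤ F₁
  loss_subgradient : ∀ i, ∀ t ≥ 1, ∀ x ∈ X, ∃ v, IsSubgradientOn X (f i t) x v ∧ ‖v‖ ≤ F₂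
  constraint_subgradient : ∀ i, ∀ t ≥ 1, ∀ x ∈ X,
    ∃ D, IsVecSubgradientOn X (g i t) x D ∧ ‖D‖ ≤ F₂

/-- Assumptions on the time-varying directed graphs `G t` (`(G t).Adj j i` says that `(j, i)` is an
edge, so that `i` receives from `j`) and on the mixing matrices `W t`, for `t ≥ 1`. -/
structure MixingNetwork {n : ℕ} (G : ℕ → Digraph (Fin n)) (W : ℕ → Matrix (Fin n) (Fin n) ℝ)
    (w : ℝ) (B : ℕ) : Prop where
  weight_pos : ∀ t ≥ 1, ∀ i j, ((G t).Adj j i ∨ i = j) → 0 < W t i j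
  weight_zero : ∀ t ≥ 1, ∀ i j, ¬ ((G t).Adj j i ∨ i = j) → W t i j = 0
  weight_lower : ∀ t ≥ 1, ∀ i j, 0 < W t i j → w ≤ W t i j
  row_sum : ∀ t ≥ 1, ∀ i, ∑ j, W t i j = 1
  col_sum : ∀ t ≥ 1, ∀ j, ∑ i, W t i j = 1
  /-- the union of any `B` consecutive graphs is strongly connected -/
  jointly_connected : ∀ t ≥ 1, ∀ i j,
    Relation.ReflTransGen (fun a b => ∃ l < B, (G (t + l)).Adj a b) i j

/-- The sequences occurring in the algorithm, indexed by agent and time `t ≥ 1` (index `0` is not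
used): local decisions `x`, last broadcast decisions `xhat`, consensus variables `z`, update
directions `ω`, dual variables `q`, the observed subgradients `u i t` of `f i t`, and the
transposes `D i t` of the observed subgradients of `[g i t]₊`. -/
structure Trajectory (n p : ℕ) (m : Fin n → ℕ) where
  x : Fin n → ℕ → Vec p
  xhat : Fin n → ℕ → Vec p
  z : Fin n → ℕ → Vec p
  ω : Fin n → ℕ → Vec p
  q : (i : Fin n) → ℕ → Vec (m i)
  u : Fin n → ℕ → Vec p
  D : (i : Fin n) → ℕ → (Vec p →L[ℝ] Vec (m i))

/-- `s` is generated by the distributed event-triggered online primal-dual algorithm with step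
sizes `α`, `β`, regularization `γ` and triggering thresholds `τ`. The observed subgradients are
arbitrary subgradients, relative to `X`, that obey the bound `F₂`. -/
structure Generated {n p : ℕ} {m : Fin n → ℕ} (X : Set (Vec p)) (f : Fin n → ℕ → Vec p → ℝ)
    (g : (i : Fin n) → ℕ → Vec p → Vec (m i)) (F₂ : ℝ) (W : ℕ → Matrix (Fin n) (Fin n) ℝ)
    (α β γ τ : ℕ → ℝ) (s : Trajectory n p m) : Prop where
  init_x : ∀ i, s.x i 1 ∈ X
  init_xhat : ∀ i, s.xhat i 1 = s.x i 1
  init_q : ∀ i, s.q i 1 = 0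
  observe_loss : ∀ i, ∀ t ≥ 1, IsSubgradientOn X (f i t) (s.x i t) (s.u i t)
  observe_loss_bound : ∀ i, ∀ t ≥ 1, ‖s.u i t‖ ≤ F₂
  observe_constraint : ∀ i, ∀ t ≥ 1,
    IsVecSubgradientOn X (fun x => posVec (g i t x)) (s.x i t) (s.D i t)
  observe_constraint_bound : ∀ i, ∀ t ≥ 1, ‖s.D i t‖ ≤ F₂
  consensus : ∀ i, ∀ t ≥ 1, s.z i (t + 1) = ∑ j, W t i j • s.xhat j t
  direction : ∀ i, ∀ t ≥ 1,
    s.ω i (t + 1) = s.u i t + ContinuousLinearMap.adjoint (s.D i t) (s.q i t)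
  primal : ∀ i, ∀ t ≥ 1, IsProj X (s.z i (t + 1) - α (t + 1) • s.ω i (t + 1)) (s.x i (t + 1))
  dual : ∀ i, ∀ t ≥ 1, s.q i (t + 1) =
    posVec ((1 - β (t + 1) * γ (t + 1)) • s.q i t +
      γ (t + 1) • (posVec (g i t (s.x i t)) + s.D i t (s.x i (t + 1) - s.x i t)))
  trigger : ∀ i, ∀ t ≥ 1, τ (t + 1) ≤ ‖s.x i (t + 1) - s.xhat i t‖ →
    s.xhat i (t + 1) = s.x i (t + 1)
  no_trigger : ∀ i, ∀ t ≥ 1, ‖s.x i (t + 1) - s.xhat i t‖ < τ (t + 1) →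
    s.xhat i (t + 1) = s.xhat i t

/-- Global loss `f_t = (1/n) ∑ⱼ f_{j,t}`. -/
def globalLoss {n p : ℕ} (f : Fin n → ℕ → Vec p → ℝ) (t : ℕ) (x : Vec p) : ℝ :=
  (1 / (n : ℝ)) * ∑ j, f j t x

/-- Global constraint `g_t = col(g_{1,t}, …, g_{n,t})`, a vector with `∑ⱼ mⱼ` components. -/
def globalConstraint {n p : ℕ} {m : Fin n → ℕ} (g : (i : Fin n) → ℕ → Vec p → Vec (m i))
    (t : ℕ) (x : Vec p) : EuclideanSpace ℝ ((i : Fin n) × Fin (m i)) :=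
  WithLp.toLp 2 (fun k => g k.1 t x k.2)

/-- Feasible decision sequences over the horizon `T` (only the entries `1, …, T` matter). -/
def feasibleSeqs {n p : ℕ} {m : Fin n → ℕ} (X : Set (Vec p))
    (g : (i : Fin n) → ℕ → Vec p → Vec (m i)) (T : ℕ) : Set (ℕ → Vec p) :=
  {y | ∀ t ∈ Finset.Icc 1 T, y t ∈ X ∧ ∀ k, globalConstraint g t (y t) k ≤ 0}

/-- Decisions whose constant sequence is feasible over the horizon `T`. -/
def feasibleStatic {n p : ℕ} {m : Fin n → ℕ} (X : Set (Vec p))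
    (g : (i : Fin n) → ℕ → Vec p → Vec (m i)) (T : ℕ) : Set (Vec p) :=
  {y | (fun _ => y) ∈ feasibleSeqs X g T}

/-- Network regret of the decisions `x` against the comparator sequence `y`. -/
def netReg {n p : ℕ} (f : Fin n → ℕ → Vec p → ℝ) (x : Fin n → ℕ → Vec p) (y : ℕ → Vec p)
    (T : ℕ) : ℝ :=
  (1 / (n : ℝ)) * ∑ i, ∑ t ∈ Finset.Icc 1 T, globalLoss f t (x i t) -
    ∑ t ∈ Finset.Icc 1 T, globalLoss f t (y t)

/-- Network cumulative constraint violation of the decisions `x`. -/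
def netCCV {n p : ℕ} {m : Fin n → ℕ} (g : (i : Fin n) → ℕ → Vec p → Vec (m i))
    (x : Fin n → ℕ → Vec p) (T : ℕ) : ℝ :=
  (1 / (n : ℝ)) * ∑ i, ∑ t ∈ Finset.Icc 1 T, ‖posVec (globalConstraint g t (x i t))‖

/-- Path length `P_T = ∑_{t=1}^{T-1} ‖y_{t+1} - y_t‖`. -/
def pathLength {p : ℕ} (y : ℕ → Vec p) (T : ℕ) : ℝ :=
  ∑ t ∈ Finset.Ico 1 T, ‖y (t + 1) - y t‖

/-- Triggering threshold `τ_t = 1 / t^θ`. -/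
def tauSeq (θ : ℝ) (t : ℕ) : ℝ := 1 / (t : ℝ) ^ θ

/-- `Ψ_t = ∑_{s=1}^t τ_s`. -/
def psiSeq (τ : ℕ → ℝ) (t : ℕ) : ℝ := ∑ s ∈ Finset.Icc 1 t, τ s

/-- Primal step size `α_t = √(Ψ_t / t)`. -/
def alphaSeq (τ : ℕ → ℝ) (t : ℕ) : ℝ := √(psiSeq τ t / (t : ℝ))

/-- Dual step size `β_t = 1 / t^κ`. -/
def betaSeq (κ : ℝ) (t : ℕ) : ℝ := 1 / (t : ℝ) ^ κ

/-- Regularization parameter `γ_t = 1 / t^(1-κ)`. -/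
def gammaSeq (κ : ℝ) (t : ℕ) : ℝ := 1 / (t : ℝ) ^ (1 - κ)

end

end EventTriggered

/-!
Doubly stochastic averaging over a network that is connected in every window of `B` steps contracts
the dispersion of the broadcast decisions geometrically, so the disagreement of the agents is
controlled by the lengths of the gradient steps and by the triggering thresholds. Nonexpansiveness
of the projection gives a one-step inequality for the primal drift, and strong concavity of the
regularized Lagrangian in the dual variable gives one for the dual drift. Summed over time, they
bound, for every `r ≥ 0`, the regret plus `r` times the violation by a quadratic polynomial in `r`
whose coefficients are sublinear in `T`. The choice `r = 0` bounds the regret. Since the regret is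
at least of order `-T`, the `r` that balances the two error terms bounds the violation. The three
regimes for `θ` are those of the growth of `∑ t ^ (-θ)`.
-/

namespace EventTriggered

open Finset

section Averaging

variable {ι E : Type*} [Fintype ι] [NormedAddCommGroup E] [NormedSpace ℝ E]

/-- One round of averaging: the action of a matrix of weights on a family of vectors. -/
def mix (P : Matrix ι ι ℝ) (y : ι → E) (i : ι) : E := ∑ j, P i j • y j

/-- The average of a family of vectors. -/
noncomputable def mean (y : ι → E) : E := (Fintype.card ι : ℝ)⁻¹ • ∑ i, y i

/-- The total deviation of a family of vectors from its average, which measures the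
disagreement of the agents. -/
noncomputable def dispersion (y : ι → E) : ℝ := ∑ i, ‖y i - mean y‖

theorem mix_sub (P : Matrix ι ι ℝ) (y v : ι → E) : mix P (y - v) = mix P y - mix P v := by
  ext i
  simp only [mix, Pi.sub_apply, smul_sub, sum_sub_distrib]

theorem mix_mul (P Q : Matrix ι ι ℝ) (y : ι → E) : mix (P * Q) y = mix P (mix Q y) := by
  ext i
  simp only [mix, Matrix.mul_apply, sum_smul, smul_sum, smul_smul]
  exact sum_comm

theorem sum_norm_mix_le {P : Matrix ι ι ℝ} {r : ℝ} (hP : ∀ i j, 0 ≤ P i j)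
    (hr : ∀ j, ∑ i, P i j = r) (y : ι → E) : ∑ i, ‖mix P y i‖ ≤ r * ∑ i, ‖y i‖ :=
  calc ∑ i, ‖mix P y i‖ ≤ ∑ i, ∑ j, P i j * ‖y j‖ := by
        refine sum_le_sum fun i _ => norm_sum_le_of_le _ fun j _ => ?_
        rw [norm_smul, Real.norm_of_nonneg (hP i j)]
    _ = r * ∑ i, ‖y i‖ := by
        rw [sum_comm, mul_sum]
        exact sum_congr rfl fun j _ => by rw [← sum_mul, hr]

theorem mean_add (y v : ι → E) : mean (y + v) = mean y + mean v := by
  simp only [mean, Pi.add_apply, sum_add_distrib, smul_add]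

theorem card_smul_mean (y : ι → E) : (Fintype.card ι : ℝ) • mean y = ∑ i, y i := by
  rcases isEmpty_or_nonempty ι with _ | _
  · simp
  · exact smul_inv_smul₀ (by simp) _

theorem card_mul_norm_mean_le (y : ι → E) : Fintype.card ι * ‖mean y‖ ≤ ∑ i, ‖y i‖ :=
  calc Fintype.card ι * ‖mean y‖ = ‖∑ i, y i‖ := by
        rw [← card_smul_mean, norm_smul, Real.norm_natCast]
    _ ≤ ∑ i, ‖y i‖ := norm_sum_le _ _

theorem sum_sub_mean (y : ι → E) : ∑ i, (y i - mean y) = 0 := by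
  rw [sum_sub_distrib, sum_const, card_univ, ← Nat.cast_smul_eq_nsmul ℝ, card_smul_mean, sub_self]

theorem dispersion_nonneg (y : ι → E) : 0 ≤ dispersion y := sum_nonneg fun _ _ => norm_nonneg _

theorem dispersion_le (y : ι → E) : dispersion y ≤ 2 * ∑ i, ‖y i‖ :=
  calc dispersion y ≤ ∑ i, (‖y i‖ + ‖mean y‖) := sum_le_sum fun _ _ => norm_sub_le _ _
    _ = ∑ i, ‖y i‖ + Fintype.card ι * ‖mean y‖ := by simp [sum_add_distrib]
    _ ≤ 2 * ∑ i, ‖y i‖ := by linarith [card_mul_norm_mean_le y]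

theorem dispersion_add_le (y v : ι → E) : dispersion (y + v) ≤ dispersion y + dispersion v := by
  rw [dispersion, dispersion, dispersion, ← sum_add_distrib]
  refine sum_le_sum fun i _ => ?_
  rw [mean_add, Pi.add_apply, add_sub_add_comm]
  exact norm_add_le _ _

theorem sum_sum_norm_sub_le (y : ι → E) :
    ∑ i, ∑ j, ‖y i - y j‖ ≤ 2 * Fintype.card ι * dispersion y :=
  calc ∑ i, ∑ j, ‖y i - y j‖ ≤ ∑ i, ∑ j, (‖y i - mean y‖ + ‖y j - mean y‖) :=
        sum_le_sum fun i _ => sum_le_sum fun j _ => by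
          simpa only [dist_eq_norm] using dist_triangle_right (y i) (y j) (mean y)
    _ = 2 * Fintype.card ι * dispersion y := by
        simp only [sum_add_distrib, sum_const, card_univ, nsmul_eq_mul, ← mul_sum, dispersion]
        ring

variable [DecidableEq ι] {P : Matrix ι ι ℝ}

theorem mix_one (y : ι → E) : mix 1 y = y := by
  ext i
  simp [mix, Matrix.one_apply]

theorem mix_const (hP : P ∈ doublyStochastic ℝ ι) (c : E) : mix P (fun _ => c) = fun _ => c := by
  ext i
  rw [mix, ← sum_smul, sum_row_of_mem_doublyStochastic hP, one_smul]

theorem mean_mix (hP : P ∈ doublyStochastic ℝ ι) (y : ι → E) : mean (mix P y) = mean y := by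
  simp only [mean, mix]
  rw [sum_comm]
  simp only [← sum_smul, sum_col_of_mem_doublyStochastic hP, one_smul]

theorem mix_sub_const (hP : P ∈ doublyStochastic ℝ ι) (y : ι → E) (c : E) (i : ι) :
    mix P y i - c = mix P (fun j => y j - c) i := by
  have h := congrFun (mix_sub P y fun _ => c) i
  rw [Pi.sub_apply, mix_const hP] at h
  exact h.symm

-- Since the deviations sum to zero, subtracting `η` from every weight does not change the mixture.
theorem dispersion_mix_le (hP : P ∈ doublyStochastic ℝ ι) {η : ℝ} (hη : 0 ≤ η)
    (hPη : ∀ i j, η ≤ P i j) (y : ι → E) : dispersion (mix P y) ≤ (1 - η) * dispersion y := by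
  rcases isEmpty_or_nonempty ι with _ | _
  · simp [dispersion]
  have hcard : (1 : ℝ) ≤ Fintype.card ι := mod_cast Fintype.card_pos
  have hmix (i : ι) : mix P y i - mean (mix P y) =
      mix (fun i j => P i j - η) (fun j => y j - mean y) i := by
    rw [mean_mix hP, mix_sub_const hP]
    simp only [mix, sub_smul, sum_sub_distrib (f := fun j => P i j • _), ← smul_sum,
      sum_sub_mean, smul_zero, sub_zero]
  have hcol (j : ι) : ∑ i, (P i j - η) = 1 - Fintype.card ι * η := by
    simp [sum_sub_distrib, sum_col_of_mem_doublyStochastic hP]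
  calc dispersion (mix P y) ≤ (1 - Fintype.card ι * η) * dispersion y := by
        simp only [dispersion, hmix]
        exact sum_norm_mix_le (fun i j => sub_nonneg.2 (hPη i j)) hcol _
    _ ≤ (1 - η) * dispersion y := by
        gcongr
        · exact dispersion_nonneg y
        · exact le_mul_of_one_le_left hη hcard

theorem sum_norm_sub_mix_le (hP : P ∈ doublyStochastic ℝ ι) (y : ι → E) :
    ∑ i, ‖y i - mix P y i‖ ≤ 2 * dispersion y :=
  calc ∑ i, ‖y i - mix P y i‖
      ≤ ∑ i, (‖y i - mean y‖ + ‖mix P (fun j => y j - mean y) i‖) := by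
        refine sum_le_sum fun i _ => ?_
        rw [← mix_sub_const hP]
        simpa only [dist_eq_norm] using dist_triangle_right (y i) (mix P y i) (mean y)
    _ ≤ dispersion y + 1 * dispersion y := by
        rw [sum_add_distrib]
        gcongr
        · exact le_rfl
        · exact sum_norm_mix_le (fun _ _ => nonneg_of_mem_doublyStochastic hP)
            (sum_col_of_mem_doublyStochastic hP) _
    _ = 2 * dispersion y := by ring

theorem sum_sq_norm_mix_le (hP : P ∈ doublyStochastic ℝ ι) (y : ι → E) :
    ∑ i, ‖mix P y i‖ ^ 2 ≤ ∑ i, ‖y i‖ ^ 2 :=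
  calc ∑ i, ‖mix P y i‖ ^ 2 ≤ ∑ i, ∑ j, P i j * ‖y j‖ ^ 2 := by
        refine sum_le_sum fun i _ => ?_
        exact (convexOn_norm convex_univ).pow (fun _ _ => norm_nonneg _) 2 |>.map_sum_le
          (fun j _ => nonneg_of_mem_doublyStochastic hP)
          (sum_row_of_mem_doublyStochastic hP i) (fun _ _ => Set.mem_univ _)
    _ = ∑ j, ‖y j‖ ^ 2 := by
        rw [sum_comm]
        simp only [← sum_mul, sum_col_of_mem_doublyStochastic hP, one_mul]

end Averaging

/-- The product `W (s + k - 1) * ⋯ * W (s + 1) * W s` of the `k` weight matrices from time `s`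
on. -/
def mixProd {ι : Type*} [Fintype ι] [DecidableEq ι] (W : ℕ → Matrix ι ι ℝ) (s : ℕ) :
    ℕ → Matrix ι ι ℝ
  | 0 => 1
  | k + 1 => W (s + k) * mixProd W s k

section PerturbedConsensus

variable {ι E : Type*} [Fintype ι] [NormedAddCommGroup E] [NormedSpace ℝ E]

/-- The one-step errors of `y` as a solution of the consensus iteration
`y (t + 1) = mix (W t) (y t)`, summed over the agents. -/
noncomputable def consensusError (W : ℕ → Matrix ι ι ℝ) (y : ℕ → ι → E) (t : ℕ) : ℝ :=
  ∑ i, ‖y (t + 1) i - mix (W t) (y t) i‖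

theorem consensusError_nonneg (W : ℕ → Matrix ι ι ℝ) (y : ℕ → ι → E) (t : ℕ) :
    0 ≤ consensusError W y t :=
  sum_nonneg fun _ _ => norm_nonneg _

variable [DecidableEq ι] {W : ℕ → Matrix ι ι ℝ}

theorem mixProd_mem_doublyStochastic {s : ℕ} (hW : ∀ t ≥ s, W t ∈ doublyStochastic ℝ ι) (k : ℕ) :
    mixProd W s k ∈ doublyStochastic ℝ ι := by
  induction k with
  | zero => exact one_mem _
  | succ k ih => exact mul_mem (hW _ (s.le_add_right k)) ih

theorem sum_norm_sub_mix_mixProd_le {s : ℕ} (hW : ∀ t ≥ s, W t ∈ doublyStochastic ℝ ι)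
    (y : ℕ → ι → E) (k : ℕ) :
    ∑ i, ‖y (s + k) i - mix (mixProd W s k) (y s) i‖ ≤
      ∑ l ∈ range k, consensusError W y (s + l) := by
  induction k with
  | zero => simp [mixProd, mix_one]
  | succ k ih =>
    have hWk := hW _ (s.le_add_right k)
    have herr : y (s + k + 1) - mix (mixProd W s (k + 1)) (y s) =
        mix (W (s + k)) (y (s + k) - mix (mixProd W s k) (y s)) +
          (y (s + k + 1) - mix (W (s + k)) (y (s + k))) := by
      rw [mixProd, mix_mul, mix_sub]
      abel
    have hmix := sum_norm_mix_le (fun _ _ => nonneg_of_mem_doublyStochastic hWk)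
      (sum_col_of_mem_doublyStochastic hWk) (y (s + k) - mix (mixProd W s k) (y s))
    rw [one_mul] at hmix
    calc ∑ i, ‖y (s + (k + 1)) i - mix (mixProd W s (k + 1)) (y s) i‖
        ≤ ∑ i, (‖mix (W (s + k)) (y (s + k) - mix (mixProd W s k) (y s)) i‖ +
            ‖y (s + k + 1) i - mix (W (s + k)) (y (s + k)) i‖) :=
          sum_le_sum fun i _ => (congrArg norm (congrFun herr i)).trans_le (norm_add_le _ _)
      _ ≤ _ := by
          rw [sum_add_distrib, sum_range_succ]
          exact add_le_add (hmix.trans ih) le_rfl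

theorem dispersion_add_le_of_le_mixProd {s k : ℕ} (hW : ∀ t ≥ s, W t ∈ doublyStochastic ℝ ι)
    {η : ℝ} (hη : 0 ≤ η) (hWη : ∀ i j, η ≤ mixProd W s k i j) (y : ℕ → ι → E) :
    dispersion (y (s + k)) ≤ (1 - η) * dispersion (y s) +
      2 * ∑ l ∈ range k, consensusError W y (s + l) := by
  set v := y (s + k) - mix (mixProd W s k) (y s) with hv
  calc dispersion (y (s + k)) = dispersion (mix (mixProd W s k) (y s) + v) := by
        rw [hv, add_sub_cancel]
    _ ≤ dispersion (mix (mixProd W s k) (y s)) + dispersion v := dispersion_add_le _ _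
    _ ≤ _ := add_le_add (dispersion_mix_le (mixProd_mem_doublyStochastic hW k) hη hWη _)
        ((dispersion_le v).trans (by gcongr; exact sum_norm_sub_mix_mixProd_le hW y k))

theorem sum_range_sum_range_add_le {δ : ℕ → ℝ} (hδ : ∀ t, 0 ≤ δ t) (L N : ℕ) :
    ∑ t ∈ range N, ∑ l ∈ range L, δ (t + l) ≤ L * ∑ t ∈ range (L + N), δ t := by
  have hwindow : ∀ l ∈ range L, ∑ t ∈ range N, δ (t + l) ≤ ∑ t ∈ range (L + N), δ t := by
    intro l hl
    rw [mem_range] at hl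
    rw [range_eq_Ico, sum_Ico_add']
    exact sum_le_sum_of_subset_of_nonneg
      (fun t ht => by simp only [mem_Ico, mem_range] at ht ⊢; omega) fun t _ _ => hδ t
  calc ∑ t ∈ range N, ∑ l ∈ range L, δ (t + l) = ∑ l ∈ range L, ∑ t ∈ range N, δ (t + l) :=
        sum_comm
    _ ≤ ∑ _l ∈ range L, ∑ t ∈ range (L + N), δ t := sum_le_sum hwindow
    _ = L * ∑ t ∈ range (L + N), δ t := by simp

theorem mul_sum_le_of_contraction {a δ : ℕ → ℝ} {η M : ℝ} {L : ℕ} (hη : η ≤ 1)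
    (ha : ∀ t, 0 ≤ a t) (haM : ∀ t, a t ≤ M) (hδ : ∀ t, 0 ≤ δ t)
    (hstep : ∀ t, a (t + L) ≤ (1 - η) * a t + ∑ l ∈ range L, δ (t + l)) (T : ℕ) :
    η * ∑ t ∈ range T, a t ≤ L * (M + ∑ t ∈ range T, δ t) := by
  have hhead : ∀ N ≤ L, ∑ t ∈ range N, a t ≤ L * M := fun N hN =>
    calc ∑ t ∈ range N, a t ≤ ∑ _t ∈ range N, M := sum_le_sum fun t _ => haM t
      _ = N * M := by simp
      _ ≤ L * M := by
        gcongr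
        exact (ha 0).trans (haM 0)
  suffices hsum : ∑ t ∈ range T, a t ≤
      L * M + ((1 - η) * ∑ t ∈ range T, a t + L * ∑ t ∈ range T, δ t) by linarith
  have hη' : 0 ≤ 1 - η := sub_nonneg.2 hη
  rcases le_total T L with hT | hT
  · have hrest : 0 ≤ (1 - η) * ∑ t ∈ range T, a t + L * ∑ t ∈ range T, δ t :=
      add_nonneg (mul_nonneg hη' (sum_nonneg fun t _ => ha t))
        (mul_nonneg L.cast_nonneg (sum_nonneg fun t _ => hδ t))
    linarith [hhead T hT]
  · obtain ⟨N, rfl⟩ := Nat.exists_eq_add_of_le hT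
    have htail : ∑ t ∈ range N, a (L + t) ≤
        (1 - η) * ∑ t ∈ range (L + N), a t + L * ∑ t ∈ range (L + N), δ t :=
      calc ∑ t ∈ range N, a (L + t)
          ≤ ∑ t ∈ range N, ((1 - η) * a t + ∑ l ∈ range L, δ (t + l)) :=
            sum_le_sum fun t _ => by rw [add_comm]; exact hstep t
        _ = (1 - η) * ∑ t ∈ range N, a t + ∑ t ∈ range N, ∑ l ∈ range L, δ (t + l) := by
            rw [sum_add_distrib, mul_sum]
        _ ≤ _ := by
            refine add_le_add (mul_le_mul_of_nonneg_left ?_ hη')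
              (sum_range_sum_range_add_le hδ L N)
            exact sum_le_sum_of_subset_of_nonneg (range_mono (by omega)) fun t _ _ => ha t
    exact (sum_range_add a L N).trans_le (add_le_add (hhead L le_rfl) htail)

end PerturbedConsensus

theorem sum_range_succ_eq_sum_Icc {M : Type*} [AddCommMonoid M] (a : ℕ → M) (T : ℕ) :
    ∑ t ∈ range T, a (t + 1) = ∑ t ∈ Icc 1 T, a t := by
  rw [range_eq_Ico, sum_Ico_add', zero_add, Ico_add_one_right_eq_Icc]

section Network

variable {n : ℕ} {G : ℕ → Digraph (Fin n)} {W : ℕ → Matrix (Fin n) (Fin n) ℝ} {w : ℝ} {B : ℕ}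

theorem MixingNetwork.mem_doublyStochastic (hW : MixingNetwork G W w B) {t : ℕ} (ht : 1 ≤ t) :
    W t ∈ doublyStochastic ℝ (Fin n) := by
  refine mem_doublyStochastic_iff_sum.2 ⟨fun i j => ?_, hW.row_sum t ht, hW.col_sum t ht⟩
  by_cases hij : (G t).Adj j i ∨ i = j
  · exact (hW.weight_pos t ht i j hij).le
  · exact (hW.weight_zero t ht i j hij).ge

theorem MixingNetwork.mixProd_mem_doublyStochastic (hW : MixingNetwork G W w B) {s : ℕ}
    (hs : 1 ≤ s) (k : ℕ) : mixProd W s k ∈ doublyStochastic ℝ (Fin n) :=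
  EventTriggered.mixProd_mem_doublyStochastic
    (fun _ ht => hW.mem_doublyStochastic (hs.trans ht)) k

theorem MixingNetwork.pow_succ_le_mixProd (hW : MixingNetwork G W w B) (hw : 0 < w) {s : ℕ}
    (hs : 1 ≤ s) {k : ℕ} {i a j : Fin n} (ha : w ^ k ≤ mixProd W s k a j)
    (hi : (G (s + k)).Adj a i ∨ i = a) : w ^ (k + 1) ≤ mixProd W s (k + 1) i j := by
  have hsk : 1 ≤ s + k := hs.trans (s.le_add_right k)
  have hweight : w ≤ W (s + k) i a := hW.weight_lower _ hsk _ _ (hW.weight_pos _ hsk _ _ hi)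
  rw [mixProd, Matrix.mul_apply]
  calc w ^ (k + 1) = w * w ^ k := pow_succ' w k
    _ ≤ W (s + k) i a * mixProd W s k a j :=
        mul_le_mul hweight ha (pow_nonneg hw.le _) (hw.le.trans hweight)
    _ ≤ ∑ a, W (s + k) i a * mixProd W s k a j :=
        single_le_sum (f := fun a => W (s + k) i a * mixProd W s k a j)
          (fun a _ => mul_nonneg (nonneg_of_mem_doublyStochastic (hW.mem_doublyStochastic hsk))
            (nonneg_of_mem_doublyStochastic (hW.mixProd_mem_doublyStochastic hs k)))
          (mem_univ a)

theorem MixingNetwork.pow_add_le_mixProd (hW : MixingNetwork G W w B) (hw : 0 < w) {s : ℕ}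
    (hs : 1 ≤ s) {k : ℕ} (l : ℕ) {i j : Fin n} (hi : w ^ k ≤ mixProd W s k i j) :
    w ^ (k + l) ≤ mixProd W s (k + l) i j := by
  induction l with
  | zero => exact hi
  | succ l ih => exact hW.pow_succ_le_mixProd hw hs ih (Or.inr rfl)

theorem MixingNetwork.pow_add_le_mixProd_of_adj (hW : MixingNetwork G W w B) (hw : 0 < w) {s : ℕ}
    (hs : 1 ≤ s) {k l : ℕ} (hl : l < B) {a b j : Fin n} (hab : (G (s + k + l)).Adj a b)
    (ha : w ^ k ≤ mixProd W s k a j) : w ^ (k + B) ≤ mixProd W s (k + B) b j := by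
  obtain ⟨r, rfl⟩ := Nat.exists_eq_add_of_lt hl
  have hb := hW.pow_succ_le_mixProd hw hs (hW.pow_add_le_mixProd hw hs l ha)
    (Or.inl (by rwa [← add_assoc]))
  convert hW.pow_add_le_mixProd hw hs r hb using 2 <;> ring

theorem exists_crossing {α : Type*} {r : α → α → Prop} {S : Set α} {a b : α}
    (hab : Relation.ReflTransGen r a b) (ha : a ∈ S) (hb : b ∉ S) : ∃ c ∈ S, ∃ d ∉ S, r c d := by
  contrapose! hb
  induction hab with
  | refl => exact ha
  | tail _ hcd ih => exact by_contra fun hd => hb _ ih _ hd hcd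

/-- The agents whose variable at time `s + k` depends on that of agent `j` at time `s` with weight
at least `w ^ k`. -/
noncomputable def influenced (W : ℕ → Matrix (Fin n) (Fin n) ℝ) (w : ℝ) (s k : ℕ) (j : Fin n) :
    Finset (Fin n) :=
  univ.filter fun i => w ^ k ≤ mixProd W s k i j

theorem mem_influenced {s k : ℕ} {i j : Fin n} :
    i ∈ influenced W w s k j ↔ w ^ k ≤ mixProd W s k i j := by
  simp [influenced]

theorem MixingNetwork.influenced_subset (hW : MixingNetwork G W w B) (hw : 0 < w) {s : ℕ}
    (hs : 1 ≤ s) (k l : ℕ) (j : Fin n) : influenced W w s k j ⊆ influenced W w s (k + l) j :=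
  fun _ hi => mem_influenced.2 (hW.pow_add_le_mixProd hw hs l (mem_influenced.1 hi))

theorem MixingNetwork.influenced_ssubset (hW : MixingNetwork G W w B) (hw : 0 < w) {s : ℕ}
    (hs : 1 ≤ s) (k : ℕ) (j : Fin n) (hk : influenced W w s k j ≠ univ) :
    influenced W w s k j ⊂ influenced W w s (k + B) j := by
  obtain ⟨i, hi⟩ : ∃ i, i ∉ influenced W w s k j := by
    simpa [eq_univ_iff_forall] using hk
  have hj : j ∈ influenced W w s k j := by
    simpa using hW.influenced_subset hw hs 0 k j (mem_influenced.2 (by simp [mixProd]))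
  obtain ⟨a, ha, b, hb, l, hl, hab⟩ :=
    exists_crossing (S := ↑(influenced W w s k j))
      (hW.jointly_connected (s + k) (hs.trans (s.le_add_right k)) j i) hj hi
  refine (ssubset_iff_of_subset (hW.influenced_subset hw hs k B j)).2 ⟨b, ?_, hb⟩
  exact mem_influenced.2 (hW.pow_add_le_mixProd_of_adj hw hs hl hab (mem_influenced.1 ha))

theorem MixingNetwork.le_card_influenced (hW : MixingNetwork G W w B) (hw : 0 < w) {s : ℕ}
    (hs : 1 ≤ s) (j : Fin n) {c : ℕ} (hc : c ≤ n) : c ≤ #(influenced W w s (c * B) j) := by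
  induction c with
  | zero => exact Nat.zero_le _
  | succ c ih =>
    rw [add_mul, one_mul]
    by_cases hall : influenced W w s (c * B) j = univ
    · have hsub := card_le_card (hW.influenced_subset hw hs (c * B) B j)
      rw [hall, card_univ, Fintype.card_fin] at hsub
      exact hc.trans hsub
    · exact Nat.succ_le_of_lt ((ih (Nat.le_of_succ_le hc)).trans_lt
        (card_lt_card (hW.influenced_ssubset hw hs (c * B) j hall)))

theorem MixingNetwork.pow_le_mixProd (hW : MixingNetwork G W w B) (hw : 0 < w) {s : ℕ}
    (hs : 1 ≤ s) (i j : Fin n) : w ^ (n * B) ≤ mixProd W s (n * B) i j := by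
  have hall : influenced W w s (n * B) j = univ := by
    refine eq_univ_of_card _ ((card_finset_fin_le _).antisymm ?_ |>.trans (Fintype.card_fin n).symm)
    exact hW.le_card_influenced hw hs j le_rfl
  exact mem_influenced.1 (hall ▸ mem_univ i)

theorem MixingNetwork.pow_le_one (hW : MixingNetwork G W w B) (hw : 0 < w) : w ^ (n * B) ≤ 1 := by
  rcases n.eq_zero_or_pos with rfl | hn
  · simp
  · exact (hW.pow_le_mixProd hw le_rfl ⟨0, hn⟩ ⟨0, hn⟩).trans
      (le_one_of_mem_doublyStochastic (hW.mixProd_mem_doublyStochastic le_rfl _))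

theorem MixingNetwork.mul_sum_dispersion_le {E : Type*} [NormedAddCommGroup E] [NormedSpace ℝ E]
    (hW : MixingNetwork G W w B) (hw : 0 < w) {y : ℕ → Fin n → E} {M : ℝ}
    (hM : ∀ t ≥ 1, dispersion (y t) ≤ M) (T : ℕ) :
    w ^ (n * B) * ∑ t ∈ Icc 1 T, dispersion (y t) ≤
      (n * B : ℕ) * (M + 2 * ∑ t ∈ Icc 1 T, consensusError W y t) := by
  have hone : ∀ t, dispersion (y (t + 1 + n * B)) ≤ (1 - w ^ (n * B)) * dispersion (y (t + 1)) +
      2 * ∑ l ∈ range (n * B), consensusError W y (t + 1 + l) := fun t =>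
    dispersion_add_le_of_le_mixProd
      (fun r hr => hW.mem_doublyStochastic ((Nat.le_add_left 1 t).trans hr))
      (pow_nonneg hw.le _) (fun i j => hW.pow_le_mixProd hw (Nat.le_add_left 1 t) i j) y
  have hcontr := mul_sum_le_of_contraction (a := fun t => dispersion (y (t + 1)))
    (δ := fun t => 2 * consensusError W y (t + 1)) (hW.pow_le_one hw)
    (fun t => dispersion_nonneg _) (fun t => hM _ (Nat.le_add_left 1 t))
    (fun t => mul_nonneg zero_le_two (consensusError_nonneg W y _))
    (fun t => by simpa only [← mul_sum, add_right_comm t _ 1] using hone t) T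
  rwa [← mul_sum, sum_range_succ_eq_sum_Icc fun t => dispersion (y t),
    sum_range_succ_eq_sum_Icc fun t => consensusError W y t] at hcontr

end Network

section PosVec

theorem posVec_nonneg {ι : Type*} (v : EuclideanSpace ℝ ι) (k : ι) : 0 ≤ posVec v k :=
  le_max_right _ _

theorem posVec_of_nonneg {ι : Type*} {v : EuclideanSpace ℝ ι} (hv : ∀ k, 0 ≤ v k) :
    posVec v = v := by
  ext k
  exact max_eq_left (hv k)

theorem posVec_of_nonpos {ι : Type*} {v : EuclideanSpace ℝ ι} (hv : ∀ k, v k ≤ 0) :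
    posVec v = 0 := by
  ext k
  exact max_eq_right (hv k)

/-- The all-ones vector. -/
noncomputable def ones (ι : Type*) : EuclideanSpace ℝ ι := WithLp.toLp 2 fun _ => 1

variable {ι : Type*} [Fintype ι]

theorem norm_le_norm_of_abs_le {v u : EuclideanSpace ℝ ι} (h : ∀ k, |v k| ≤ |u k|) :
    ‖v‖ ≤ ‖u‖ := by
  rw [EuclideanSpace.norm_eq, EuclideanSpace.norm_eq]
  exact Real.sqrt_le_sqrt (sum_le_sum fun k _ => by simpa using sq_le_sq.2 (h k))

theorem norm_posVec_le (v : EuclideanSpace ℝ ι) : ‖posVec v‖ ≤ ‖v‖ :=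
  norm_le_norm_of_abs_le fun k => by
    rw [abs_of_nonneg (posVec_nonneg v k)]
    exact max_le (le_abs_self _) (abs_nonneg _)

theorem norm_posVec_sub_posVec_le (v u : EuclideanSpace ℝ ι) :
    ‖posVec v - posVec u‖ ≤ ‖v - u‖ :=
  norm_le_norm_of_abs_le fun k => by
    simpa [posVec] using abs_max_sub_max_le_abs (v k) (u k) 0

theorem norm_posVec_le_add {a b v : EuclideanSpace ℝ ι} (h : ∀ k, a k ≤ b k + v k) :
    ‖posVec a‖ ≤ ‖posVec b‖ + ‖v‖ := by
  have hmono : ‖posVec a‖ ≤ ‖posVec (b + v)‖ := norm_le_norm_of_abs_le fun k => by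
    rw [abs_of_nonneg (posVec_nonneg a k), abs_of_nonneg (posVec_nonneg _ k)]
    exact max_le_max_right 0 (h k)
  have hlip := norm_posVec_sub_posVec_le (b + v) b
  rw [add_sub_cancel_left] at hlip
  linarith [norm_sub_norm_le (posVec (b + v)) (posVec b)]

theorem inner_nonneg_of_nonneg {v u : EuclideanSpace ℝ ι} (hv : ∀ k, 0 ≤ v k)
    (hu : ∀ k, 0 ≤ u k) : 0 ≤ inner ℝ v u := by
  rw [PiLp.inner_apply]
  exact sum_nonneg fun k _ => by simpa using mul_nonneg (hu k) (hv k)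

theorem norm_ones : ‖ones ι‖ = √(Fintype.card ι) := by
  simp [ones, EuclideanSpace.norm_eq]

theorem norm_le_inner_ones {v : EuclideanSpace ℝ ι} (hv : ∀ k, 0 ≤ v k) :
    ‖v‖ ≤ inner ℝ (ones ι) v := by
  have hinner : inner ℝ (ones ι) v = ∑ k, v k := by simp [PiLp.inner_apply, ones]
  rw [hinner, EuclideanSpace.norm_eq]
  refine Real.sqrt_le_iff.2 ⟨sum_nonneg fun k _ => hv k, ?_⟩
  simp only [Real.norm_eq_abs, sq_abs]
  exact sum_sq_le_sq_sum_of_nonneg fun k _ => hv k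

end PosVec

section Dual

/-- The conditions on the dual step sizes `β` and the regularization `γ` under which the dual
iteration is analysed; the last one makes the dual potential telescope. -/
structure DualStepSizes (β γ : ℕ → ℝ) : Prop where
  β_pos : ∀ t ≥ 1, 0 < β t
  β_succ_le : ∀ t ≥ 1, β (t + 1) ≤ β t
  γ_pos : ∀ t ≥ 1, 0 < γ t
  β_mul_γ_le_one : ∀ t ≥ 1, β t * γ t ≤ 1
  inv_γ_succ_sub_β_le : ∀ t ≥ 1, (γ (t + 1))⁻¹ - β (t + 1) ≤ (γ t)⁻¹

variable {ι : Type*} [Fintype ι]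

-- `b - β Q` is the gradient of the Lagrangian minus `β / 2 * ‖·‖ ^ 2`, which is `β`-strongly
-- concave in the dual variable; this is where the term `‖u‖ ^ 2 / 2 * β` comes from.
theorem inner_sub_le_of_dual_step {Q b u : EuclideanSpace ℝ ι} {β γ M : ℝ} (hγ : 0 < γ)
    (hβ : 0 < β) (hu : ∀ k, 0 ≤ u k) (hb : ‖b - β • Q‖ ≤ 2 * M) :
    inner ℝ (u - Q) b ≤
      ((γ⁻¹ - β) * ‖Q - u‖ ^ 2 - γ⁻¹ * ‖posVec ((1 - β * γ) • Q + γ • b) - u‖ ^ 2) / 2 +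
        (‖u‖ ^ 2 / 2 * β + 2 * M ^ 2 * γ) := by
  set Q' := posVec ((1 - β * γ) • Q + γ • b)
  have hproj : ‖Q' - u‖ ≤ ‖(Q - u) + γ • (b - β • Q)‖ := by
    have hlip := norm_posVec_sub_posVec_le ((1 - β * γ) • Q + γ • b) u
    rw [posVec_of_nonneg hu] at hlip
    convert hlip using 2
    module
  have hstep : ‖Q' - u‖ ^ 2 ≤
      ‖Q - u‖ ^ 2 + 2 * γ * inner ℝ (Q - u) (b - β • Q) + γ ^ 2 * (2 * M) ^ 2 :=
    calc ‖Q' - u‖ ^ 2 ≤ ‖(Q - u) + γ • (b - β • Q)‖ ^ 2 := by gcongr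
      _ = ‖Q - u‖ ^ 2 + 2 * γ * inner ℝ (Q - u) (b - β • Q) + γ ^ 2 * ‖b - β • Q‖ ^ 2 := by
        rw [norm_add_sq_real, inner_smul_right, norm_smul, Real.norm_of_nonneg hγ.le]
        ring
      _ ≤ _ := by gcongr
  have hconcave : inner ℝ (Q - u) (b - β • Q) ≤
      -inner ℝ (u - Q) b - β / 2 * (‖Q - u‖ ^ 2 - ‖u‖ ^ 2) := by
    have hexpand : inner ℝ (Q - u) (b - β • Q) =
        -inner ℝ (u - Q) b - β / 2 * (‖Q‖ ^ 2 + ‖Q - u‖ ^ 2 - ‖u‖ ^ 2) := by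
      rw [inner_sub_right, inner_smul_right, norm_sub_sq_real, inner_sub_left, inner_sub_left,
        inner_sub_left, real_inner_self_eq_norm_sq, real_inner_comm u Q]
      ring
    have hQ : 0 ≤ β / 2 * ‖Q‖ ^ 2 := by positivity
    linarith
  have hdiv : γ⁻¹ * ‖Q' - u‖ ^ 2 ≤
      γ⁻¹ * ‖Q - u‖ ^ 2 + 2 * inner ℝ (Q - u) (b - β • Q) + 4 * M ^ 2 * γ := by
    rw [inv_mul_le_iff₀ hγ]
    refine hstep.trans_eq ?_
    field_simp
    ring
  linarith

variable {q b : ℕ → EuclideanSpace ℝ ι} {β γ : ℕ → ℝ} {M : ℝ}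

theorem DualStepSizes.mul_norm_le (hS : DualStepSizes β γ) (hq₁ : q 1 = 0)
    (hq : ∀ t ≥ 1, q (t + 1) = posVec ((1 - β (t + 1) * γ (t + 1)) • q t + γ (t + 1) • b t))
    (hb : ∀ t ≥ 1, ‖b t‖ ≤ M) {t : ℕ} (ht : 1 ≤ t) : β t * ‖q t‖ ≤ M := by
  induction t, ht using Nat.le_induction with
  | base => simpa [hq₁] using (norm_nonneg _).trans (hb 1 le_rfl)
  | succ t ht ih =>
    have ht' : 1 ≤ t + 1 := Nat.le_add_left 1 t
    have hβ := hS.β_pos (t + 1) ht'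
    have hγ := hS.γ_pos (t + 1) ht'
    have hβγ : 0 ≤ 1 - β (t + 1) * γ (t + 1) := sub_nonneg.2 (hS.β_mul_γ_le_one _ ht')
    have ih' : β (t + 1) * ‖q t‖ ≤ M :=
      (mul_le_mul_of_nonneg_right (hS.β_succ_le t ht) (norm_nonneg _)).trans ih
    have hqt : ‖q (t + 1)‖ ≤ (1 - β (t + 1) * γ (t + 1)) * ‖q t‖ + γ (t + 1) * M := by
      rw [hq t ht]
      refine (norm_posVec_le _).trans ((norm_add_le _ _).trans ?_)
      rw [norm_smul, norm_smul, Real.norm_of_nonneg hβγ, Real.norm_of_nonneg hγ.le]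
      gcongr
      exact hb t ht
    calc β (t + 1) * ‖q (t + 1)‖
        ≤ β (t + 1) * ((1 - β (t + 1) * γ (t + 1)) * ‖q t‖ + γ (t + 1) * M) := by gcongr
      _ = (1 - β (t + 1) * γ (t + 1)) * (β (t + 1) * ‖q t‖) + β (t + 1) * γ (t + 1) * M := by
        ring
      _ ≤ (1 - β (t + 1) * γ (t + 1)) * M + β (t + 1) * γ (t + 1) * M := by gcongr
      _ = M := by ring

theorem sum_Icc_one_sub_succ (a : ℕ → ℝ) (T : ℕ) :
    ∑ t ∈ Icc 1 T, (a t - a (t + 1)) = a 1 - a (T + 1) := by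
  rw [← sum_range_succ_eq_sum_Icc fun t => a t - a (t + 1), sum_range_sub' fun t => a (t + 1)]

theorem DualStepSizes.sum_inner_le (hS : DualStepSizes β γ) (hq₁ : q 1 = 0)
    (hq : ∀ t ≥ 1, q (t + 1) = posVec ((1 - β (t + 1) * γ (t + 1)) • q t + γ (t + 1) • b t))
    (hb : ∀ t ≥ 1, ‖b t‖ ≤ M) {u : EuclideanSpace ℝ ι} (hu : ∀ k, 0 ≤ u k) (T : ℕ) :
    ∑ t ∈ Icc 1 T, inner ℝ (u - q t) (b t) ≤
      ‖u‖ ^ 2 / 2 * ((γ 1)⁻¹ + ∑ t ∈ Icc 1 T, β (t + 1)) +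
        2 * M ^ 2 * ∑ t ∈ Icc 1 T, γ (t + 1) := by
  set Φ : ℕ → ℝ := fun t => (γ t)⁻¹ * ‖q t - u‖ ^ 2 with hΦ
  have hstep : ∀ t ∈ Icc 1 T, inner ℝ (u - q t) (b t) ≤
      (Φ t - Φ (t + 1)) / 2 + (‖u‖ ^ 2 / 2 * β (t + 1) + 2 * M ^ 2 * γ (t + 1)) := by
    intro t ht
    have ht₁ := (mem_Icc.1 ht).1
    have ht' : 1 ≤ t + 1 := Nat.le_add_left 1 t
    have hβ := hS.β_pos _ ht'
    have hdir : ‖b t - β (t + 1) • q t‖ ≤ 2 * M := by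
      refine (norm_sub_le _ _).trans ?_
      rw [norm_smul, Real.norm_of_nonneg hβ.le]
      linarith [hb t ht₁, hS.mul_norm_le hq₁ hq hb ht₁,
        mul_le_mul_of_nonneg_right (hS.β_succ_le t ht₁) (norm_nonneg (q t))]
    have hone := inner_sub_le_of_dual_step (hS.γ_pos _ ht') hβ hu hdir
    rw [← hq t ht₁] at hone
    have hdrift :=
      mul_le_mul_of_nonneg_right (hS.inv_γ_succ_sub_β_le t ht₁) (sq_nonneg ‖q t - u‖)
    simp only [hΦ]
    linarith
  have hΦ₁ : Φ 1 = (γ 1)⁻¹ * ‖u‖ ^ 2 := by simp [hΦ, hq₁]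
  have hΦT : 0 ≤ Φ (T + 1) :=
    mul_nonneg (inv_nonneg.2 (hS.γ_pos _ (Nat.le_add_left 1 T)).le) (sq_nonneg _)
  refine (sum_le_sum hstep).trans ?_
  rw [sum_add_distrib, sum_add_distrib, ← sum_div, sum_Icc_one_sub_succ, ← mul_sum, ← mul_sum, hΦ₁]
  linarith

end Dual

section Primal

variable {E : Type*} [NormedAddCommGroup E] [InnerProductSpace ℝ E] {K : Set E} {v x y : E}

theorem IsProj.inner_le (h : IsProj K v x) (hK : Convex ℝ K) (hy : y ∈ K) :
    inner ℝ (v - x) (y - x) ≤ (0 : ℝ) := by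
  refine (norm_eq_iInf_iff_real_inner_le_zero hK h.1).1 ?_ y hy
  have : Nonempty K := ⟨⟨x, h.1⟩⟩
  exact le_antisymm (le_ciInf fun u => h.2 u u.2)
    (ciInf_le ⟨0, Set.forall_mem_range.2 fun _ => norm_nonneg _⟩ (⟨x, h.1⟩ : K))

theorem IsProj.step_le {z d : E} {a : ℝ} (h : IsProj K (z - a • d) x) (hK : Convex ℝ K)
    (hy : y ∈ K) :
    2 * a * inner ℝ d (x - y) ≤ ‖z - y‖ ^ 2 - ‖x - y‖ ^ 2 - ‖x - z‖ ^ 2 := by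
  have hinner : inner ℝ (z - a • d - x) (y - x) =
      a * (inner ℝ d (x - y) : ℝ) - inner ℝ (z - x) (x - y) := by
    rw [sub_right_comm, inner_sub_left, real_inner_smul_left, ← neg_sub x y, inner_neg_right,
      inner_neg_right]
    ring
  have hexpand : ‖z - y‖ ^ 2 = ‖x - z‖ ^ 2 + 2 * inner ℝ (z - x) (x - y) + ‖x - y‖ ^ 2 := by
    rw [norm_sub_rev x z, ← norm_add_sq_real, sub_add_sub_cancel]
  linarith [h.inner_le hK hy]

end Primal

section Agent

variable {n p : ℕ} {m : Fin n → ℕ} {X : Set (Vec p)} {f : Fin n → ℕ → Vec p → ℝ}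
  {g : (i : Fin n) → ℕ → Vec p → Vec (m i)} {R F₁ F₂ : ℝ}

theorem ConvexProblem.norm_sub_le (hP : ConvexProblem X f g R F₁ F₂) {x y : Vec p} (hx : x ∈ X)
    (hy : y ∈ X) : ‖x - y‖ ≤ 2 * R := by
  linarith [_root_.norm_sub_le x y, hP.bounded x hx, hP.bounded y hy]

theorem ConvexProblem.loss_sub_le (hP : ConvexProblem X f g R F₁ F₂) (i : Fin n) {t : ℕ}
    (ht : 1 ≤ t) {x y : Vec p} (hx : x ∈ X) (hy : y ∈ X) :
    f i t x - f i t y ≤ F₂ * ‖x - y‖ := by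
  obtain ⟨v, hv, hvF⟩ := hP.loss_subgradient i t ht x hx
  calc f i t x - f i t y ≤ inner ℝ v (x - y) := by
        rw [← neg_sub y x, inner_neg_right]
        linarith [hv y hy]
    _ ≤ ‖v‖ * ‖x - y‖ := real_inner_le_norm _ _
    _ ≤ F₂ * ‖x - y‖ := by gcongr

theorem ConvexProblem.norm_posVec_constraint_le (hP : ConvexProblem X f g R F₁ F₂) (i : Fin n)
    {t : ℕ} (ht : 1 ≤ t) {x y : Vec p} (hx : x ∈ X) (hy : y ∈ X) :
    ‖posVec (g i t x)‖ ≤ ‖posVec (g i t y)‖ + F₂ * ‖x - y‖ := by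
  obtain ⟨D, hD, hDF⟩ := hP.constraint_subgradient i t ht x hx
  have hlin : ∀ k, g i t x k ≤ g i t y k + D (x - y) k := fun k => by
    have hk := hD k y hy
    rw [← neg_sub x y, map_neg, PiLp.neg_apply] at hk
    linarith
  exact (norm_posVec_le_add hlin).trans (by gcongr; exact D.le_of_opNorm_le hDF _)

variable {W : ℕ → Matrix (Fin n) (Fin n) ℝ} {α β γ τ : ℕ → ℝ} {s : Trajectory n p m}

theorem Generated.x_mem (h : Generated X f g F₂ W α β γ τ s) (i : Fin n) {t : ℕ} (ht : 1 ≤ t) :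
    s.x i t ∈ X := by
  cases t, ht using Nat.le_induction with
  | base => exact h.init_x i
  | succ t ht => exact (h.primal i t ht).1

theorem Generated.xhat_mem (h : Generated X f g F₂ W α β γ τ s) (i : Fin n) {t : ℕ}
    (ht : 1 ≤ t) : s.xhat i t ∈ X := by
  induction t, ht using Nat.le_induction with
  | base => exact h.init_xhat i ▸ h.init_x i
  | succ t ht ih =>
    rcases le_or_gt (τ (t + 1)) ‖s.x i (t + 1) - s.xhat i t‖ with hτ | hτ
    · exact h.trigger i t ht hτ ▸ h.x_mem i (Nat.le_add_left 1 t)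
    · exact h.no_trigger i t ht hτ ▸ ih

theorem Generated.norm_xhat_sub_le (h : Generated X f g F₂ W α β γ τ s) (hτ : ∀ t ≥ 1, 0 ≤ τ t)
    (i : Fin n) {t : ℕ} (ht : 1 ≤ t) : ‖s.xhat i t - s.x i t‖ ≤ τ t := by
  cases t, ht using Nat.le_induction with
  | base => simpa [h.init_xhat] using hτ 1 le_rfl
  | succ t ht =>
    rcases le_or_gt (τ (t + 1)) ‖s.x i (t + 1) - s.xhat i t‖ with hc | hc
    · simpa [h.trigger i t ht hc] using hτ (t + 1) (Nat.le_add_left 1 t)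
    · rw [h.no_trigger i t ht hc, norm_sub_rev]
      exact hc.le

theorem Generated.q_nonneg (h : Generated X f g F₂ W α β γ τ s) (i : Fin n) {t : ℕ}
    (ht : 1 ≤ t) (k : Fin (m i)) : 0 ≤ s.q i t k := by
  cases t, ht using Nat.le_induction with
  | base => simp [h.init_q]
  | succ t ht => exact h.dual i t ht ▸ posVec_nonneg _ k

/-- The linearized constraint value that drives the dual update of agent `i`. -/
noncomputable def Trajectory.dualStep (s : Trajectory n p m)
    (g : (i : Fin n) → ℕ → Vec p → Vec (m i)) (i : Fin n) (t : ℕ) : Vec (m i) :=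
  posVec (g i t (s.x i t)) + s.D i t (s.x i (t + 1) - s.x i t)

theorem Generated.norm_D_apply_le (h : Generated X f g F₂ W α β γ τ s) (i : Fin n) {t : ℕ}
    (ht : 1 ≤ t) (v : Vec p) : ‖s.D i t v‖ ≤ F₂ * ‖v‖ :=
  (s.D i t).le_of_opNorm_le (h.observe_constraint_bound i t ht) v

theorem Generated.norm_dualStep_le (h : Generated X f g F₂ W α β γ τ s)
    (hP : ConvexProblem X f g R F₁ F₂) (i : Fin n) {t : ℕ} (ht : 1 ≤ t) :
    ‖s.dualStep g i t‖ ≤ F₁ + F₂ * (2 * R) := by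
  have hF₂ : 0 ≤ F₂ := (norm_nonneg _).trans (h.observe_constraint_bound i t ht)
  refine (norm_add_le _ _).trans (add_le_add ?_ ((h.norm_D_apply_le i ht _).trans ?_))
  · exact (norm_posVec_le _).trans (hP.constraint_bound i t ht _ (h.x_mem i ht))
  · gcongr
    exact hP.norm_sub_le (h.x_mem i (Nat.le_add_left 1 t)) (h.x_mem i ht)

theorem Generated.inner_dualStep_le (h : Generated X f g F₂ W α β γ τ s) (i : Fin n) {t : ℕ}
    (ht : 1 ≤ t) {y : Vec p} (hy : y ∈ X) (hgy : ∀ k, g i t y k ≤ 0) :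
    inner ℝ (s.q i t) (s.dualStep g i t) ≤
      (inner ℝ (s.q i t) (s.D i t (s.x i (t + 1) - y)) : ℝ) := by
  rw [← sub_nonneg, ← inner_sub_right]
  refine inner_nonneg_of_nonneg (h.q_nonneg i ht) fun k => ?_
  have hk := h.observe_constraint i t ht k y hy
  simp only [posVec_of_nonpos hgy, PiLp.zero_apply] at hk
  rw [← sub_sub_sub_cancel_right (s.x i (t + 1)) y (s.x i t), map_sub, Trajectory.dualStep]
  simp only [PiLp.sub_apply, PiLp.add_apply]
  linarith

theorem Generated.norm_posVec_sub_le_inner_ones_dualStep (h : Generated X f g F₂ W α β γ τ s)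
    (i : Fin n) {t : ℕ} (ht : 1 ≤ t) :
    ‖posVec (g i t (s.x i t))‖ - ‖ones (Fin (m i))‖ * (F₂ * ‖s.x i (t + 1) - s.x i t‖) ≤
      inner ℝ (ones (Fin (m i))) (s.dualStep g i t) := by
  have hD : ‖ones (Fin (m i))‖ * ‖s.D i t (s.x i (t + 1) - s.x i t)‖ ≤
      ‖ones (Fin (m i))‖ * (F₂ * ‖s.x i (t + 1) - s.x i t‖) := by
    gcongr
    exact h.norm_D_apply_le i ht _
  rw [Trajectory.dualStep, inner_add_right]
  linarith [norm_le_inner_ones (posVec_nonneg (g i t (s.x i t))),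
    neg_le_of_abs_le (abs_real_inner_le_norm (ones (Fin (m i)))
      (s.D i t (s.x i (t + 1) - s.x i t)))]

theorem Generated.loss_sub_le_inner (h : Generated X f g F₂ W α β γ τ s) (i : Fin n) {t : ℕ}
    (ht : 1 ≤ t) {y : Vec p} (hy : y ∈ X) :
    f i t (s.x i t) - f i t y ≤
      inner ℝ (s.u i t) (s.x i (t + 1) - y) + F₂ * ‖s.x i (t + 1) - s.x i t‖ := by
  have hsplit : (inner ℝ (s.u i t) (y - s.x i t) : ℝ) =
      inner ℝ (s.u i t) (s.x i (t + 1) - s.x i t) - inner ℝ (s.u i t) (s.x i (t + 1) - y) := by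
    rw [← inner_sub_right, sub_sub_sub_cancel_left]
  have hu : ‖s.u i t‖ * ‖s.x i (t + 1) - s.x i t‖ ≤ F₂ * ‖s.x i (t + 1) - s.x i t‖ := by
    gcongr
    exact h.observe_loss_bound i t ht
  linarith [h.observe_loss i t ht y hy,
    neg_le_of_abs_le (abs_real_inner_le_norm (s.u i t) (s.x i (t + 1) - s.x i t))]

theorem Generated.agent_lagrangian_le (h : Generated X f g F₂ W α β γ τ s) (hX : Convex ℝ X)
    (i : Fin n) {t : ℕ} (ht : 1 ≤ t) (hα : 0 < α (t + 1)) {r : ℝ} (hr : 0 ≤ r) {y : Vec p}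
    (hy : y ∈ X) (hgy : ∀ k, g i t y k ≤ 0) :
    f i t (s.x i t) - f i t y + r * ‖posVec (g i t (s.x i t))‖ ≤
      (2 * α (t + 1))⁻¹ * (‖s.z i (t + 1) - y‖ ^ 2 - ‖s.x i (t + 1) - y‖ ^ 2 -
        ‖s.x i (t + 1) - s.z i (t + 1)‖ ^ 2) +
      (1 + r * ‖ones (Fin (m i))‖) * F₂ * ‖s.x i (t + 1) - s.x i t‖ +
      inner ℝ (r • ones (Fin (m i)) - s.q i t) (s.dualStep g i t) := by
  have hprimal : inner ℝ (s.u i t) (s.x i (t + 1) - y) +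
      inner ℝ (s.q i t) (s.D i t (s.x i (t + 1) - y)) ≤
      (2 * α (t + 1))⁻¹ * (‖s.z i (t + 1) - y‖ ^ 2 - ‖s.x i (t + 1) - y‖ ^ 2 -
        ‖s.x i (t + 1) - s.z i (t + 1)‖ ^ 2) := by
    rw [← ContinuousLinearMap.adjoint_inner_left, ← inner_add_left, ← h.direction i t ht,
      le_inv_mul_iff₀ (by positivity)]
    exact (h.primal i t ht).step_le hX hy
  have hones := mul_le_mul_of_nonneg_left (h.norm_posVec_sub_le_inner_ones_dualStep i ht) hr
  rw [inner_sub_left, real_inner_smul_left]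
  linarith [h.loss_sub_le_inner i ht hy, h.inner_dualStep_le i ht hy hgy]

end Agent

section Coupling

theorem sq_norm_le_add {E : Type*} [SeminormedAddCommGroup E] {u v : E} {D δ : ℝ} (hu : ‖u‖ ≤ D)
    (hv : ‖v‖ ≤ D) (huv : ‖u - v‖ ≤ δ) : ‖u‖ ^ 2 ≤ ‖v‖ ^ 2 + 2 * D * δ := by
  have hdiff : ‖u‖ - ‖v‖ ≤ δ := (norm_sub_norm_le u v).trans huv
  have hδ : 0 ≤ δ := (norm_nonneg _).trans huv
  calc ‖u‖ ^ 2 = ‖v‖ ^ 2 + (‖u‖ + ‖v‖) * (‖u‖ - ‖v‖) := by ring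
    _ ≤ ‖v‖ ^ 2 + (‖u‖ + ‖v‖) * δ := by gcongr
    _ ≤ ‖v‖ ^ 2 + (D + D) * δ := by gcongr
    _ = ‖v‖ ^ 2 + 2 * D * δ := by ring

variable {n p : ℕ} {m : Fin n → ℕ} {X : Set (Vec p)} {f : Fin n → ℕ → Vec p → ℝ}
  {g : (i : Fin n) → ℕ → Vec p → Vec (m i)} {R F₁ F₂ w : ℝ} {B : ℕ} {G : ℕ → Digraph (Fin n)}
  {W : ℕ → Matrix (Fin n) (Fin n) ℝ} {α β γ τ : ℕ → ℝ} {s : Trajectory n p m}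

/-- The decisions of all agents at time `t`. -/
def Trajectory.decisions (s : Trajectory n p m) (t : ℕ) (i : Fin n) : Vec p := s.x i t

/-- The broadcast decisions of all agents at time `t`. -/
def Trajectory.broadcasts (s : Trajectory n p m) (t : ℕ) (i : Fin n) : Vec p := s.xhat i t

/-- The total distance between the decisions and the consensus variables of time `t + 1`, which
is the displacement caused by the primal step. -/
noncomputable def Trajectory.residual (s : Trajectory n p m) (t : ℕ) : ℝ :=
  ∑ i, ‖s.x i (t + 1) - s.z i (t + 1)‖

theorem Trajectory.residual_nonneg (s : Trajectory n p m) (t : ℕ) : 0 ≤ s.residual t :=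
  sum_nonneg fun _ _ => norm_nonneg _

theorem Generated.z_eq_mix (h : Generated X f g F₂ W α β γ τ s) (i : Fin n) {t : ℕ}
    (ht : 1 ≤ t) : s.z i (t + 1) = mix (W t) (s.broadcasts t) i :=
  h.consensus i t ht

theorem Generated.sum_norm_consensus_sub_mix_le (h : Generated X f g F₂ W α β γ τ s)
    (hW : MixingNetwork G W w B) (hτ : ∀ t ≥ 1, 0 ≤ τ t) {t : ℕ} (ht : 1 ≤ t) :
    ∑ i, ‖s.z i (t + 1) - mix (W t) (s.decisions t) i‖ ≤ n * τ t := by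
  have hP := hW.mem_doublyStochastic ht
  calc ∑ i, ‖s.z i (t + 1) - mix (W t) (s.decisions t) i‖
      = ∑ i, ‖mix (W t) (s.broadcasts t - s.decisions t) i‖ := by
        simp only [mix_sub, Pi.sub_apply, h.z_eq_mix _ ht]
    _ ≤ 1 * ∑ i, ‖s.xhat i t - s.x i t‖ :=
        sum_norm_mix_le (fun i j => nonneg_of_mem_doublyStochastic hP)
          (sum_col_of_mem_doublyStochastic hP) _
    _ ≤ 1 * ∑ _i : Fin n, τ t := by
        gcongr with i
        exact h.norm_xhat_sub_le hτ i ht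
    _ = n * τ t := by simp

theorem Generated.consensusError_le (h : Generated X f g F₂ W α β γ τ s)
    (hW : MixingNetwork G W w B) (hτ : ∀ t ≥ 1, 0 ≤ τ t) {t : ℕ} (ht : 1 ≤ t) :
    consensusError W s.decisions t ≤ s.residual t + n * τ t := by
  refine le_trans ?_ (add_le_add_right (h.sum_norm_consensus_sub_mix_le hW hτ ht) _)
  rw [Trajectory.residual, ← sum_add_distrib]
  exact sum_le_sum fun i _ => norm_sub_le_norm_sub_add_norm_sub _ _ _

theorem Generated.sum_norm_step_le (h : Generated X f g F₂ W α β γ τ s)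
    (hW : MixingNetwork G W w B) (hτ : ∀ t ≥ 1, 0 ≤ τ t) {t : ℕ} (ht : 1 ≤ t) :
    ∑ i, ‖s.x i (t + 1) - s.x i t‖ ≤
      s.residual t + n * τ t + 2 * dispersion (s.decisions t) := by
  refine le_trans ?_ (add_le_add (h.consensusError_le hW hτ ht)
    (sum_norm_sub_mix_le (hW.mem_doublyStochastic ht) (s.decisions t)))
  rw [consensusError, ← sum_add_distrib]
  refine sum_le_sum fun i _ => ?_
  rw [norm_sub_rev (s.decisions t i)]
  exact norm_sub_le_norm_sub_add_norm_sub _ _ _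

theorem Generated.sum_sq_consensus_le (h : Generated X f g F₂ W α β γ τ s)
    (hP : ConvexProblem X f g R F₁ F₂) (hW : MixingNetwork G W w B) (hτ : ∀ t ≥ 1, 0 ≤ τ t)
    {t : ℕ} (ht : 1 ≤ t) {y : Vec p} (hy : y ∈ X) :
    ∑ i, ‖s.z i (t + 1) - y‖ ^ 2 ≤ ∑ i, ‖s.x i t - y‖ ^ 2 + n * (4 * R * τ t) := by
  have hWt := hW.mem_doublyStochastic ht
  have hbroadcast : ∀ i, ‖s.xhat i t - y‖ ^ 2 ≤ ‖s.x i t - y‖ ^ 2 + 4 * R * τ t := fun i => by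
    have hsq := sq_norm_le_add (δ := τ t) (hP.norm_sub_le (h.xhat_mem i ht) hy)
      (hP.norm_sub_le (h.x_mem i ht) hy)
      (by simpa only [sub_sub_sub_cancel_right] using h.norm_xhat_sub_le hτ i ht)
    linarith
  calc ∑ i, ‖s.z i (t + 1) - y‖ ^ 2
      = ∑ i, ‖mix (W t) (fun j => s.broadcasts t j - y) i‖ ^ 2 := by
        simp only [h.z_eq_mix _ ht, mix_sub_const hWt]
    _ ≤ ∑ i, ‖s.broadcasts t i - y‖ ^ 2 := sum_sq_norm_mix_le hWt _
    _ ≤ ∑ i, (‖s.x i t - y‖ ^ 2 + 4 * R * τ t) := sum_le_sum fun i _ => hbroadcast i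
    _ = ∑ i, ‖s.x i t - y‖ ^ 2 + n * (4 * R * τ t) := by
        rw [sum_add_distrib, sum_const, card_univ, Fintype.card_fin, nsmul_eq_mul]

/-- The factor in the bound of the accumulated dispersion of the decisions by the accumulated
residuals and thresholds; it comes from the contraction of `n * B` rounds of averaging. -/
noncomputable def mixingConst (n B : ℕ) (w R : ℝ) : ℝ :=
  (n * B : ℕ) * (2 * n * R + 2 + 2 * n) / w ^ (n * B)

theorem mixingConst_nonneg (n B : ℕ) (hw : 0 < w) (hR : 0 ≤ R) : 0 ≤ mixingConst n B w R := by
  unfold mixingConst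
  positivity

theorem Generated.dispersion_decisions_le (h : Generated X f g F₂ W α β γ τ s)
    (hP : ConvexProblem X f g R F₁ F₂) {t : ℕ} (ht : 1 ≤ t) :
    dispersion (s.decisions t) ≤ 2 * n * R :=
  calc dispersion (s.decisions t) ≤ 2 * ∑ i, ‖s.x i t‖ := dispersion_le _
    _ ≤ 2 * ∑ _i : Fin n, R := by
        gcongr with i
        exact hP.bounded _ (h.x_mem i ht)
    _ = 2 * n * R := by simp [mul_assoc]

theorem Generated.sum_dispersion_le (h : Generated X f g F₂ W α β γ τ s)
    (hP : ConvexProblem X f g R F₁ F₂) (hW : MixingNetwork G W w B) (hw : 0 < w) (hR : 0 ≤ R)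
    (hτ : ∀ t ≥ 1, 0 ≤ τ t) (T : ℕ) :
    ∑ t ∈ Icc 1 T, dispersion (s.decisions t) ≤
      mixingConst n B w R * (1 + ∑ t ∈ Icc 1 T, s.residual t + psiSeq τ T) := by
  have hcontr := hW.mul_sum_dispersion_le hw (fun t ht => h.dispersion_decisions_le hP ht) T
  have herr : ∑ t ∈ Icc 1 T, consensusError W s.decisions t ≤
      ∑ t ∈ Icc 1 T, s.residual t + n * psiSeq τ T := by
    rw [psiSeq, mul_sum, ← sum_add_distrib]
    exact sum_le_sum fun t ht => h.consensusError_le hW hτ (mem_Icc.1 ht).1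
  have hE : 0 ≤ ∑ t ∈ Icc 1 T, s.residual t := sum_nonneg fun t _ => s.residual_nonneg t
  have hΨ : 0 ≤ psiSeq τ T := sum_nonneg fun t ht => hτ t (mem_Icc.1 ht).1
  rw [mixingConst, div_mul_eq_mul_div, le_div_iff₀' (pow_pos hw _), mul_assoc]
  refine hcontr.trans (mul_le_mul_of_nonneg_left ?_ (Nat.cast_nonneg _))
  have hcross : 0 ≤ 2 * n * R * (∑ t ∈ Icc 1 T, s.residual t + psiSeq τ T) +
      2 * n * (1 + ∑ t ∈ Icc 1 T, s.residual t) + 2 * (1 + psiSeq τ T) := by positivity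
  linarith

end Coupling

section Performance

theorem sum_sum_le_of_lipschitz {ι E : Type*} [Fintype ι] [NormedAddCommGroup E]
    [NormedSpace ℝ E] {φ : ι → E → ℝ} {y : ι → E} {L : ℝ} (hL : 0 ≤ L)
    (hφ : ∀ i j, φ j (y i) ≤ φ j (y j) + L * ‖y i - y j‖) :
    ∑ i, ∑ j, φ j (y i) ≤ Fintype.card ι * (∑ j, φ j (y j) + 2 * L * dispersion y) :=
  calc ∑ i, ∑ j, φ j (y i) ≤ ∑ i, ∑ j, (φ j (y j) + L * ‖y i - y j‖) :=
        sum_le_sum fun i _ => sum_le_sum fun j _ => hφ i j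
    _ = Fintype.card ι * ∑ j, φ j (y j) + L * ∑ i, ∑ j, ‖y i - y j‖ := by
        simp only [sum_add_distrib, ← mul_sum, sum_const, card_univ, nsmul_eq_mul]
    _ ≤ Fintype.card ι * ∑ j, φ j (y j) + L * (2 * Fintype.card ι * dispersion y) := by
        gcongr
        exact sum_sum_norm_sub_le y
    _ = Fintype.card ι * (∑ j, φ j (y j) + 2 * L * dispersion y) := by ring

variable {n p : ℕ} {m : Fin n → ℕ} {X : Set (Vec p)} {f : Fin n → ℕ → Vec p → ℝ}
  {g : (i : Fin n) → ℕ → Vec p → Vec (m i)} {R F₁ F₂ : ℝ}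
  {W : ℕ → Matrix (Fin n) (Fin n) ℝ} {α β γ τ : ℕ → ℝ} {s : Trajectory n p m}

theorem Generated.mul_netReg_le (h : Generated X f g F₂ W α β γ τ s)
    (hP : ConvexProblem X f g R F₁ F₂) (hn : 0 < n) (hF₂ : 0 ≤ F₂) (y : ℕ → Vec p) (T : ℕ) :
    n * netReg f s.x y T ≤ ∑ t ∈ Icc 1 T, ∑ i, (f i t (s.x i t) - f i t (y t)) +
      2 * F₂ * ∑ t ∈ Icc 1 T, dispersion (s.decisions t) := by
  have hn₀ : (0 : ℝ) < n := Nat.cast_pos.2 hn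
  have hreg : n * netReg f s.x y T =
      ∑ t ∈ Icc 1 T, (∑ i, globalLoss f t (s.x i t) - ∑ i, f i t (y t)) := by
    rw [netReg, sum_sub_distrib, sum_comm]
    simp only [globalLoss, ← mul_sum]
    field_simp
  rw [hreg, mul_sum, ← sum_add_distrib]
  refine sum_le_sum fun t ht => ?_
  have ht₁ := (mem_Icc.1 ht).1
  have hloss : ∑ i, globalLoss f t (s.x i t) ≤
      ∑ j, f j t (s.x j t) + 2 * F₂ * dispersion (s.decisions t) := by
    simp only [globalLoss, ← mul_sum]
    rw [one_div, inv_mul_le_iff₀ hn₀]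
    simpa [Trajectory.decisions] using sum_sum_le_of_lipschitz (φ := fun j => f j t)
      (y := s.decisions t) hF₂ fun i j =>
        sub_le_iff_le_add'.1 (hP.loss_sub_le j ht₁ (h.x_mem i ht₁) (h.x_mem j ht₁))
  rw [sum_sub_distrib]
  linarith

theorem norm_posVec_globalConstraint_le (t : ℕ) (x : Vec p) :
    ‖posVec (globalConstraint g t x)‖ ≤ ∑ i, ‖posVec (g i t x)‖ := by
  rw [EuclideanSpace.norm_eq]
  refine Real.sqrt_le_iff.2 ⟨sum_nonneg fun _ _ => norm_nonneg _, ?_⟩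
  rw [Fintype.sum_sigma]
  calc _ = ∑ i, ‖posVec (g i t x)‖ ^ 2 :=
        sum_congr rfl fun i _ => by rw [EuclideanSpace.norm_sq_eq]; rfl
    _ ≤ (∑ i, ‖posVec (g i t x)‖) ^ 2 := sum_sq_le_sq_sum_of_nonneg fun _ _ => norm_nonneg _

theorem Generated.netCCV_le (h : Generated X f g F₂ W α β γ τ s)
    (hP : ConvexProblem X f g R F₁ F₂) (hn : 0 < n) (hF₂ : 0 ≤ F₂) (T : ℕ) :
    netCCV g s.x T ≤ ∑ t ∈ Icc 1 T, ∑ i, ‖posVec (g i t (s.x i t))‖ +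
      2 * F₂ * ∑ t ∈ Icc 1 T, dispersion (s.decisions t) := by
  rw [netCCV, one_div, inv_mul_le_iff₀ (Nat.cast_pos.2 hn), sum_comm, mul_sum _ _ (2 * F₂),
    ← sum_add_distrib, mul_sum]
  refine sum_le_sum fun t ht => ?_
  have ht₁ := (mem_Icc.1 ht).1
  refine (sum_le_sum fun i _ => norm_posVec_globalConstraint_le t (s.x i t)).trans ?_
  simpa [Trajectory.decisions] using sum_sum_le_of_lipschitz
    (φ := fun j x => ‖posVec (g j t x)‖) (y := s.decisions t) hF₂ fun i j =>
      hP.norm_posVec_constraint_le j ht₁ (h.x_mem i ht₁) (h.x_mem j ht₁)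

end Performance

section Lagrangian

theorem sum_mul_sub_le_of_drift {η a c e : ℕ → ℝ} {D : ℝ} {T : ℕ} (hT : 1 ≤ T)
    (hη : ∀ t ≥ 1, 0 ≤ η t) (hη_mono : ∀ t ≥ 1, η t ≤ η (t + 1)) (hc : ∀ t ≥ 1, 0 ≤ c t)
    (ha : ∀ t ∈ Icc 1 T, a t ≤ D) (hac : ∀ t ∈ Ico 1 T, a (t + 1) ≤ c t + e t) :
    ∑ t ∈ Icc 1 T, η t * (a t - c t) ≤ η T * D + ∑ t ∈ Ico 1 T, η t * e t := by
  suffices hdrift : ∑ t ∈ Icc 1 T, η t * (a t - c t) ≤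
      η T * (D - c T) + ∑ t ∈ Ico 1 T, η t * e t by
    linarith [mul_nonneg (hη T hT) (hc T hT)]
  induction T, hT using Nat.le_induction with
  | base =>
    have h₁ := mul_le_mul_of_nonneg_left (ha 1 (by simp)) (hη 1 le_rfl)
    simp only [Icc_self, sum_singleton, Ico_self, sum_empty]
    linarith
  | succ T hT ih =>
    have hsum := ih (fun t ht => ha t (Icc_subset_Icc_right T.le_succ ht))
      fun t ht => hac t (Ico_subset_Ico_right T.le_succ ht)
    have hnext : T + 1 ∈ Icc 1 (T + 1) := mem_Icc.2 ⟨Nat.le_add_left 1 T, le_rfl⟩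
    rw [sum_Icc_succ_top (Nat.le_add_left 1 T), sum_Ico_succ_top hT]
    have hrestart : η T * (D - c T - e T) ≤ η (T + 1) * (D - a (T + 1)) :=
      calc η T * (D - c T - e T) ≤ η T * (D - a (T + 1)) := by
            refine mul_le_mul_of_nonneg_left ?_ (hη T hT)
            linarith [hac T (mem_Ico.2 ⟨hT, T.lt_succ_self⟩)]
        _ ≤ η (T + 1) * (D - a (T + 1)) :=
            mul_le_mul_of_nonneg_right (hη_mono T hT) (sub_nonneg.2 (ha _ hnext))
    linarith

theorem mul_sum_norm_le_sq_add {ι E : Type*} [Fintype ι] [SeminormedAddCommGroup E] {a : ℝ}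
    (ha : 0 < a) (k : ℝ) (v : ι → E) :
    k * ∑ i, ‖v i‖ ≤ (2 * a)⁻¹ * ∑ i, ‖v i‖ ^ 2 + Fintype.card ι * (k ^ 2 / 2 * a) := by
  have hyoung (x : ℝ) : k * x ≤ (2 * a)⁻¹ * x ^ 2 + k ^ 2 / 2 * a := by
    have hsq : 0 ≤ (2 * a)⁻¹ * (x - k * a) ^ 2 := by positivity
    have hexpand : (2 * a)⁻¹ * (x - k * a) ^ 2 =
        (2 * a)⁻¹ * x ^ 2 + k ^ 2 / 2 * a - k * x := by
      field_simp
      ring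
    linarith
  calc k * ∑ i, ‖v i‖ ≤ ∑ i, ((2 * a)⁻¹ * ‖v i‖ ^ 2 + k ^ 2 / 2 * a) := by
        rw [mul_sum]
        exact sum_le_sum fun i _ => hyoung _
    _ = (2 * a)⁻¹ * ∑ i, ‖v i‖ ^ 2 + Fintype.card ι * (k ^ 2 / 2 * a) := by
        rw [sum_add_distrib, ← mul_sum, sum_const, card_univ, nsmul_eq_mul]

/-- The properties of the step sizes and triggering thresholds on which the analysis of the
algorithm rests. -/
structure StepSizes (α β γ τ : ℕ → ℝ) : Prop extends DualStepSizes β γ where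
  α_pos : ∀ t ≥ 1, 0 < α t
  α_anti : AntitoneOn α (Set.Ici 1)
  τ_nonneg : ∀ t ≥ 1, 0 ≤ τ t

/-- A common bound of the norms of the vectors of ones of all constraint spaces; it is the factor
lost when the norm of a nonnegative vector is bounded by the sum of its components. -/
noncomputable def constraintScale {n : ℕ} (m : Fin n → ℕ) : ℝ := √(∑ i, m i)

theorem norm_ones_le_constraintScale {n : ℕ} (m : Fin n → ℕ) (i : Fin n) :
    ‖ones (Fin (m i))‖ ≤ constraintScale m := by
  rw [norm_ones, Fintype.card_fin, constraintScale]
  gcongr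
  exact_mod_cast single_le_sum (fun _ _ => Nat.zero_le _) (mem_univ i)

variable {n p : ℕ} {m : Fin n → ℕ} {X : Set (Vec p)} {f : Fin n → ℕ → Vec p → ℝ}
  {g : (i : Fin n) → ℕ → Vec p → Vec (m i)} {R F₁ F₂ w : ℝ} {B : ℕ} {G : ℕ → Digraph (Fin n)}
  {W : ℕ → Matrix (Fin n) (Fin n) ℝ} {α β γ τ : ℕ → ℝ} {s : Trajectory n p m}

theorem Generated.network_lagrangian_le (h : Generated X f g F₂ W α β γ τ s)
    (hP : ConvexProblem X f g R F₁ F₂) (hW : MixingNetwork G W w B) (hS : StepSizes α β γ τ)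
    (hF₂ : 0 ≤ F₂) {r : ℝ} (hr : 0 ≤ r) {t : ℕ} (ht : 1 ≤ t) {y : Vec p} (hy : y ∈ X)
    (hgy : ∀ i k, g i t y k ≤ 0) :
    ∑ i, (f i t (s.x i t) - f i t y) + r * ∑ i, ‖posVec (g i t (s.x i t))‖ ≤
      (2 * α (t + 1))⁻¹ * (∑ i, ‖s.x i t - y‖ ^ 2 - ∑ i, ‖s.x i (t + 1) - y‖ ^ 2 +
        n * (4 * R * τ t) - ∑ i, ‖s.x i (t + 1) - s.z i (t + 1)‖ ^ 2) +
      (1 + r * constraintScale m) * F₂ *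
        (s.residual t + n * τ t + 2 * dispersion (s.decisions t)) +
      ∑ i, inner ℝ (r • ones (Fin (m i)) - s.q i t) (s.dualStep g i t) := by
  have hα := hS.α_pos (t + 1) (Nat.le_add_left 1 t)
  calc ∑ i, (f i t (s.x i t) - f i t y) + r * ∑ i, ‖posVec (g i t (s.x i t))‖
      ≤ ∑ i, ((2 * α (t + 1))⁻¹ * (‖s.z i (t + 1) - y‖ ^ 2 - ‖s.x i (t + 1) - y‖ ^ 2 -
          ‖s.x i (t + 1) - s.z i (t + 1)‖ ^ 2) +
        (1 + r * constraintScale m) * F₂ * ‖s.x i (t + 1) - s.x i t‖ +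
        inner ℝ (r • ones (Fin (m i)) - s.q i t) (s.dualStep g i t)) := by
        rw [mul_sum, ← sum_add_distrib]
        refine sum_le_sum fun i _ =>
          (h.agent_lagrangian_le hP.convex i ht hα hr hy (hgy i)).trans ?_
        gcongr
        exact norm_ones_le_constraintScale m i
    _ = (2 * α (t + 1))⁻¹ * (∑ i, ‖s.z i (t + 1) - y‖ ^ 2 - ∑ i, ‖s.x i (t + 1) - y‖ ^ 2 -
          ∑ i, ‖s.x i (t + 1) - s.z i (t + 1)‖ ^ 2) +
        (1 + r * constraintScale m) * F₂ * ∑ i, ‖s.x i (t + 1) - s.x i t‖ +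
        ∑ i, inner ℝ (r • ones (Fin (m i)) - s.q i t) (s.dualStep g i t) := by
        simp only [sum_add_distrib, sum_sub_distrib, ← mul_sum]
    _ ≤ _ := by
        have hscale : 0 ≤ constraintScale m := Real.sqrt_nonneg _
        gcongr
        · linarith [h.sum_sq_consensus_le hP hW hS.τ_nonneg ht hy]
        · exact h.sum_norm_step_le hW hS.τ_nonneg ht

theorem Generated.sum_drift_le (h : Generated X f g F₂ W α β γ τ s)
    (hP : ConvexProblem X f g R F₁ F₂) (hS : StepSizes α β γ τ) (hR : 0 ≤ R) {T : ℕ}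
    (hT : 1 ≤ T) {y : ℕ → Vec p} (hy : ∀ t ∈ Icc 1 T, y t ∈ X) :
    ∑ t ∈ Icc 1 T, (2 * α (t + 1))⁻¹ *
        (∑ i, ‖s.x i t - y t‖ ^ 2 - ∑ i, ‖s.x i (t + 1) - y t‖ ^ 2) ≤
      n * (2 * R ^ 2) / α (T + 1) + n * (2 * R) * pathLength y T / α T := by
  have hnext (t : ℕ) : 1 ≤ t + 1 := Nat.le_add_left 1 t
  have hα (t : ℕ) : 0 < α (t + 1) := hS.α_pos _ (hnext t)
  have hdist : ∀ t ∈ Icc 1 T, ∀ k ≥ 1, ∀ i, ‖s.x i k - y t‖ ≤ 2 * R := fun t ht k hk i =>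
    hP.norm_sub_le (h.x_mem i hk) (hy t ht)
  have hdrift := sum_mul_sub_le_of_drift (η := fun t => (2 * α (t + 1))⁻¹)
    (a := fun t => ∑ i, ‖s.x i t - y t‖ ^ 2) (c := fun t => ∑ i, ‖s.x i (t + 1) - y t‖ ^ 2)
    (e := fun t => n * (2 * (2 * R) * ‖y (t + 1) - y t‖)) (D := n * (2 * R) ^ 2) hT
    (fun t _ => (inv_pos.2 (mul_pos two_pos (hα t))).le)
    (fun t _ => inv_anti₀ (mul_pos two_pos (hα _)) (mul_le_mul_of_nonneg_left
      (hS.α_anti (hnext t) (hnext (t + 1)) (Nat.le_succ _)) zero_le_two))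
    (fun t _ => by positivity)
    (fun t ht => by
      simpa using sum_le_card_nsmul univ (fun i => ‖s.x i t - y t‖ ^ 2) ((2 * R) ^ 2)
        fun i _ => by gcongr; exact hdist t ht t (mem_Icc.1 ht).1 i)
    (fun t ht => by
      have ht' := mem_Ico.1 ht
      have hsq (i : Fin n) := sq_norm_le_add (δ := ‖y (t + 1) - y t‖)
        (hdist (t + 1) (mem_Icc.2 ⟨hnext t, ht'.2⟩) (t + 1) (hnext t) i)
        (hdist t (mem_Icc.2 ⟨ht'.1, ht'.2.le⟩) (t + 1) (hnext t) i)
        (by rw [sub_sub_sub_cancel_left, norm_sub_rev])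
      simpa [sum_add_distrib] using sum_le_sum fun i (_ : i ∈ univ) => hsq i)
  have hpath : ∑ t ∈ Ico 1 T, (2 * α (t + 1))⁻¹ * (n * (2 * (2 * R) * ‖y (t + 1) - y t‖)) ≤
      n * (2 * R) * pathLength y T / α T := by
    rw [pathLength, mul_sum, sum_div]
    refine sum_le_sum fun t ht => ?_
    have ht' := mem_Ico.1 ht
    calc (2 * α (t + 1))⁻¹ * (n * (2 * (2 * R) * ‖y (t + 1) - y t‖))
        = n * (2 * R) * ‖y (t + 1) - y t‖ / α (t + 1) := by
          field_simp [(hα t).ne']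
      _ ≤ n * (2 * R) * ‖y (t + 1) - y t‖ / α T := by
          gcongr
          · exact hS.α_pos T hT
          · exact hS.α_anti (hnext t) hT ht'.2
  refine hdrift.trans (add_le_add (le_of_eq ?_) hpath)
  field_simp

theorem StepSizes.sum_threshold_div_le (hS : StepSizes α β γ τ) (T : ℕ) :
    ∑ t ∈ Icc 1 T, τ t / α (t + 1) ≤ psiSeq τ T / α (T + 1) := by
  have hnext (t : ℕ) : 1 ≤ t + 1 := Nat.le_add_left 1 t
  rw [psiSeq, sum_div]
  refine sum_le_sum fun t ht => ?_
  have ht' := mem_Icc.1 ht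
  exact div_le_div_of_nonneg_left (hS.τ_nonneg t ht'.1) (hS.α_pos _ (hnext T))
    (hS.α_anti (hnext t) (hnext T) (Nat.succ_le_succ ht'.2))

theorem Generated.sum_inner_dualStep_le (h : Generated X f g F₂ W α β γ τ s)
    (hP : ConvexProblem X f g R F₁ F₂) (hS : StepSizes α β γ τ) {r : ℝ} (hr : 0 ≤ r) (T : ℕ) :
    ∑ t ∈ Icc 1 T, ∑ i, inner ℝ (r • ones (Fin (m i)) - s.q i t) (s.dualStep g i t) ≤
      n * ((r * constraintScale m) ^ 2 / 2 * ((γ 1)⁻¹ + ∑ t ∈ Icc 1 T, β (t + 1)) +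
        2 * (F₁ + F₂ * (2 * R)) ^ 2 * ∑ t ∈ Icc 1 T, γ (t + 1)) := by
  have hβ : 0 ≤ (γ 1)⁻¹ + ∑ t ∈ Icc 1 T, β (t + 1) :=
    add_nonneg (inv_pos.2 (hS.γ_pos 1 le_rfl)).le
      (sum_nonneg fun t _ => (hS.β_pos _ (Nat.le_add_left 1 t)).le)
  have hagent (i : Fin n) :
      ∑ t ∈ Icc 1 T, inner ℝ (r • ones (Fin (m i)) - s.q i t) (s.dualStep g i t) ≤
      (r * constraintScale m) ^ 2 / 2 * ((γ 1)⁻¹ + ∑ t ∈ Icc 1 T, β (t + 1)) +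
        2 * (F₁ + F₂ * (2 * R)) ^ 2 * ∑ t ∈ Icc 1 T, γ (t + 1) := by
    refine (hS.sum_inner_le (h.init_q i) (h.dual i) (fun t ht => h.norm_dualStep_le hP i ht)
      (u := r • ones (Fin (m i))) (fun k => by simpa [ones] using hr) T).trans ?_
    rw [norm_smul, Real.norm_of_nonneg hr]
    gcongr
    exact norm_ones_le_constraintScale m i
  rw [sum_comm]
  calc _ ≤ ∑ _i : Fin n, _ := sum_le_sum fun i _ => hagent i
    _ = _ := by rw [sum_const, card_univ, Fintype.card_fin, nsmul_eq_mul]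

/-- The factor by which the coupling terms, namely the distances between consecutive decisions
and the disagreement of the agents, are bounded by the residuals and thresholds. -/
noncomputable def couplingConst {n : ℕ} (m : Fin n → ℕ) (B : ℕ) (w R F₂ : ℝ) : ℝ :=
  F₂ * ((1 + constraintScale m) * (1 + n + 2 * mixingConst n B w R) + 2 * mixingConst n B w R)

theorem couplingConst_nonneg (m : Fin n → ℕ) (B : ℕ) (hw : 0 < w) (hR : 0 ≤ R) (hF₂ : 0 ≤ F₂) :
    0 ≤ couplingConst m B w R F₂ := by
  have hmix := mixingConst_nonneg n B hw hR
  have hscale : 0 ≤ constraintScale m := Real.sqrt_nonneg _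
  unfold couplingConst
  positivity

theorem Generated.coupling_le (h : Generated X f g F₂ W α β γ τ s)
    (hP : ConvexProblem X f g R F₁ F₂) (hW : MixingNetwork G W w B) (hτ : ∀ t ≥ 1, 0 ≤ τ t)
    (hw : 0 < w) (hR : 0 ≤ R) (hF₂ : 0 ≤ F₂) {r : ℝ} (hr : 0 ≤ r) (T : ℕ) :
    (1 + r * constraintScale m) * F₂ * ∑ t ∈ Icc 1 T,
        (s.residual t + n * τ t + 2 * dispersion (s.decisions t)) +
      (1 + r) * (2 * F₂ * ∑ t ∈ Icc 1 T, dispersion (s.decisions t)) ≤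
      (1 + r) * couplingConst m B w R F₂ *
        (1 + ∑ t ∈ Icc 1 T, s.residual t + psiSeq τ T) := by
  have hE : 0 ≤ ∑ t ∈ Icc 1 T, s.residual t := sum_nonneg fun t _ => s.residual_nonneg t
  have hΨ : 0 ≤ psiSeq τ T := sum_nonneg fun t ht => hτ t (mem_Icc.1 ht).1
  have hV₀ : 0 ≤ ∑ t ∈ Icc 1 T, dispersion (s.decisions t) :=
    sum_nonneg fun t _ => dispersion_nonneg _
  have hV := h.sum_dispersion_le hP hW hw hR hτ T
  have hscale : 0 ≤ constraintScale m := Real.sqrt_nonneg _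
  have hsum : ∑ t ∈ Icc 1 T, (s.residual t + n * τ t + 2 * dispersion (s.decisions t)) =
      ∑ t ∈ Icc 1 T, s.residual t + n * psiSeq τ T +
        2 * ∑ t ∈ Icc 1 T, dispersion (s.decisions t) := by
    simp only [sum_add_distrib, ← mul_sum, psiSeq]
  rw [hsum]
  set E := ∑ t ∈ Icc 1 T, s.residual t
  set V := ∑ t ∈ Icc 1 T, dispersion (s.decisions t)
  set S := 1 + E + psiSeq τ T with hS
  have hmove : E + n * psiSeq τ T + 2 * V ≤ (1 + n + 2 * mixingConst n B w R) * S := by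
    have hcross : 0 ≤ 1 + psiSeq τ T + n * (1 + E) := by positivity
    rw [hS] at hV ⊢
    linarith
  calc (1 + r * constraintScale m) * F₂ * (E + n * psiSeq τ T + 2 * V) + (1 + r) * (2 * F₂ * V)
      ≤ (1 + r) * (1 + constraintScale m) * F₂ * ((1 + n + 2 * mixingConst n B w R) * S) +
        (1 + r) * (2 * F₂ * (mixingConst n B w R * S)) := by
        gcongr
        linarith
    _ = (1 + r) * couplingConst m B w R F₂ * S := by
        rw [couplingConst]
        ring

end Lagrangian

section LagrangianBound

variable {n p : ℕ} {m : Fin n → ℕ} {X : Set (Vec p)} {f : Fin n → ℕ → Vec p → ℝ}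
  {g : (i : Fin n) → ℕ → Vec p → Vec (m i)} {R F₁ F₂ w : ℝ} {B : ℕ} {G : ℕ → Digraph (Fin n)}
  {W : ℕ → Matrix (Fin n) (Fin n) ℝ} {α β γ τ : ℕ → ℝ} {s : Trajectory n p m}

theorem Trajectory.mul_sum_residual_le (s : Trajectory n p m) (hα : ∀ t ≥ 1, 0 < α t) (k : ℝ)
    (T : ℕ) :
    k * ∑ t ∈ Icc 1 T, s.residual t ≤
      ∑ t ∈ Icc 1 T, (2 * α (t + 1))⁻¹ * ∑ i, ‖s.x i (t + 1) - s.z i (t + 1)‖ ^ 2 +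
        n * (k ^ 2 / 2 * ∑ t ∈ Icc 1 T, α (t + 1)) := by
  simp only [mul_sum (Icc 1 T)]
  rw [← sum_add_distrib]
  refine sum_le_sum fun t _ => ?_
  simpa only [Trajectory.residual, Fintype.card_fin] using
    mul_sum_norm_le_sq_add (hα (t + 1) (Nat.le_add_left 1 t)) k fun i =>
      s.x i (t + 1) - s.z i (t + 1)

theorem Generated.sum_lagrangian_le (h : Generated X f g F₂ W α β γ τ s)
    (hP : ConvexProblem X f g R F₁ F₂) (hW : MixingNetwork G W w B) (hS : StepSizes α β γ τ)
    (hR : 0 ≤ R) (hF₂ : 0 ≤ F₂) {r : ℝ} (hr : 0 ≤ r) {T : ℕ} (hT : 1 ≤ T) {y : ℕ → Vec p}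
    (hy : y ∈ feasibleSeqs X g T) :
    ∑ t ∈ Icc 1 T, ∑ i, (f i t (s.x i t) - f i t (y t)) +
        r * ∑ t ∈ Icc 1 T, ∑ i, ‖posVec (g i t (s.x i t))‖ ≤
      n * (2 * R ^ 2) / α (T + 1) + n * (2 * R) * pathLength y T / α T +
      n * (2 * R) * (psiSeq τ T / α (T + 1)) -
      ∑ t ∈ Icc 1 T, (2 * α (t + 1))⁻¹ * ∑ i, ‖s.x i (t + 1) - s.z i (t + 1)‖ ^ 2 +
      (1 + r * constraintScale m) * F₂ * ∑ t ∈ Icc 1 T,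
        (s.residual t + n * τ t + 2 * dispersion (s.decisions t)) +
      n * ((r * constraintScale m) ^ 2 / 2 * ((γ 1)⁻¹ + ∑ t ∈ Icc 1 T, β (t + 1)) +
        2 * (F₁ + F₂ * (2 * R)) ^ 2 * ∑ t ∈ Icc 1 T, γ (t + 1)) := by
  have hstep := sum_le_sum fun t (ht : t ∈ Icc 1 T) =>
    h.network_lagrangian_le hP hW hS hF₂ hr (mem_Icc.1 ht).1 (hy t ht).1
      fun i k => (hy t ht).2 ⟨i, k⟩
  simp only [mul_add, mul_sub, sum_add_distrib, sum_sub_distrib, ← mul_sum] at hstep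
  have hdrift := h.sum_drift_le hP hS hR hT fun t ht => (hy t ht).1
  simp only [mul_sub, sum_sub_distrib] at hdrift
  have htrigger : ∑ t ∈ Icc 1 T, (2 * α (t + 1))⁻¹ * (n * (4 * R * τ t)) ≤
      n * (2 * R) * (psiSeq τ T / α (T + 1)) := by
    refine le_trans (le_of_eq ?_)
      (mul_le_mul_of_nonneg_left (hS.sum_threshold_div_le T) (by positivity))
    rw [mul_sum]
    refine sum_congr rfl fun t _ => ?_
    rw [mul_inv, div_eq_mul_inv]
    ring
  have hdual := h.sum_inner_dualStep_le hP hS hr T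
  simp only [sum_add_distrib, sum_sub_distrib, ← mul_sum, mul_add] at hdual ⊢
  linarith

theorem Generated.lagrangian_le (h : Generated X f g F₂ W α β γ τ s)
    (hP : ConvexProblem X f g R F₁ F₂) (hW : MixingNetwork G W w B) (hS : StepSizes α β γ τ)
    (hn : 0 < n) (hw : 0 < w) (hR : 0 ≤ R) (hF₂ : 0 ≤ F₂) {r : ℝ} (hr : 0 ≤ r) {T : ℕ}
    (hT : 1 ≤ T) {y : ℕ → Vec p} (hy : y ∈ feasibleSeqs X g T) :
    n * netReg f s.x y T + r * netCCV g s.x T ≤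
      n * (2 * R ^ 2) / α (T + 1) + n * (2 * R) * pathLength y T / α T +
      n * (2 * R) * (psiSeq τ T / α (T + 1)) +
      (1 + r) * couplingConst m B w R F₂ * (1 + psiSeq τ T) +
      n * (((1 + r) * couplingConst m B w R F₂) ^ 2 / 2 * ∑ t ∈ Icc 1 T, α (t + 1)) +
      n * ((r * constraintScale m) ^ 2 / 2 * ((γ 1)⁻¹ + ∑ t ∈ Icc 1 T, β (t + 1)) +
        2 * (F₁ + F₂ * (2 * R)) ^ 2 * ∑ t ∈ Icc 1 T, γ (t + 1)) := by
  linarith [h.mul_netReg_le hP hn hF₂ y T,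
    mul_le_mul_of_nonneg_left (h.netCCV_le hP hn hF₂ T) hr,
    h.sum_lagrangian_le hP hW hS hR hF₂ hr hT hy,
    h.coupling_le hP hW hS.τ_nonneg hw hR hF₂ hr T,
    s.mul_sum_residual_le hS.α_pos ((1 + r) * couplingConst m B w R F₂) T]

end LagrangianBound

section PowerSums

theorem rpow_add_mul_rpow_sub_one_le {b x : ℝ} (hb₀ : 0 ≤ b) (hb₁ : b ≤ 1) (hx : 0 ≤ x) :
    x ^ b + b * (x + 1) ^ (b - 1) ≤ (x + 1) ^ b := by
  have hx' : 0 < x + 1 := by positivity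
  have hfrac : 0 ≤ 1 + -(1 / (x + 1)) := by
    rw [← sub_eq_add_neg, sub_nonneg, div_le_one hx']
    linarith
  have hbernoulli := rpow_one_add_le_one_add_mul_self
    (show -1 ≤ -(1 / (x + 1)) by linarith) hb₀ hb₁
  calc x ^ b + b * (x + 1) ^ (b - 1)
      = (x + 1) ^ b * (1 + -(1 / (x + 1))) ^ b + b * (x + 1) ^ (b - 1) := by
        rw [← Real.mul_rpow hx'.le hfrac]
        congr 2
        field_simp
        ring
    _ ≤ (x + 1) ^ b * (1 + b * -(1 / (x + 1))) + b * (x + 1) ^ (b - 1) := by gcongr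
    _ = (x + 1) ^ b := by
        rw [Real.rpow_sub_one hx'.ne']
        ring

theorem sum_Icc_one_div_rpow_le {a : ℝ} (ha₀ : 0 ≤ a) (ha₁ : a < 1) (T : ℕ) :
    ∑ t ∈ Icc 1 T, 1 / (t : ℝ) ^ a ≤ (T : ℝ) ^ (1 - a) / (1 - a) := by
  have hb : 0 < 1 - a := sub_pos.2 ha₁
  induction T with
  | zero => simp [Real.zero_rpow hb.ne']
  | succ T ih =>
    rw [sum_Icc_succ_top (Nat.le_add_left 1 T)]
    refine (add_le_add_left ih _).trans ?_
    rw [div_add' _ _ _ hb.ne']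
    refine div_le_div_of_nonneg_right ?_ hb.le
    have hstep := rpow_add_mul_rpow_sub_one_le hb.le (sub_le_self 1 ha₀) (Nat.cast_nonneg T)
    rw [sub_sub_cancel_left, Real.rpow_neg (by positivity)] at hstep
    push_cast
    rwa [one_div, mul_comm _ (1 - a)]

theorem antitoneOn_one_div_rpow {a : ℝ} (ha : 0 ≤ a) :
    AntitoneOn (fun t : ℕ => 1 / (t : ℝ) ^ a) (Set.Ici 1) := by
  intro s hs t _ hst
  have hs₀ : (0 : ℝ) < s := Nat.cast_pos.2 hs
  dsimp only
  gcongr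

theorem sum_one_div_succ_rpow_le {a : ℝ} (ha₀ : 0 ≤ a) (ha₁ : a < 1) (T : ℕ) :
    ∑ t ∈ Icc 1 T, 1 / ((t + 1 : ℕ) : ℝ) ^ a ≤ (T : ℝ) ^ (1 - a) / (1 - a) := by
  refine le_trans (sum_le_sum fun t ht => ?_) (sum_Icc_one_div_rpow_le ha₀ ha₁ T)
  exact antitoneOn_one_div_rpow ha₀ (mem_Icc.1 ht).1 (Nat.le_add_left 1 t) (Nat.le_succ t)

theorem mul_sqrt_div_self {x : ℝ} (hx : 0 ≤ x) (y : ℝ) : x * √(y / x) = √(y * x) := by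
  rw [Real.sqrt_div' y hx, Real.sqrt_mul' y hx, mul_div_left_comm, Real.div_sqrt]

end PowerSums

/-- The triggering thresholds for which the step sizes `α` of the algorithm are admissible. Their
first term only fixes the scale, so it is normalized to one. -/
structure ThresholdSequence (τ : ℕ → ℝ) : Prop where
  pos : ∀ t ≥ 1, 0 < τ t
  antitoneOn : AntitoneOn τ (Set.Ici 1)
  one_eq_one : τ 1 = 1

namespace ThresholdSequence

variable {τ : ℕ → ℝ} {κ : ℝ} {T : ℕ}

theorem psiSeq_mono (hτ : ThresholdSequence τ) : Monotone (psiSeq τ) := fun _ _ h =>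
  sum_le_sum_of_subset_of_nonneg (Icc_subset_Icc_right h)
    fun t ht _ => (hτ.pos t (mem_Icc.1 ht).1).le

theorem one_le_psiSeq (hτ : ThresholdSequence τ) (hT : 1 ≤ T) : 1 ≤ psiSeq τ T := by
  simpa [psiSeq, hτ.one_eq_one] using hτ.psiSeq_mono hT

theorem mul_le_psiSeq (hτ : ThresholdSequence τ) {S : ℕ} (h : T ≤ S) :
    T * τ S ≤ psiSeq τ T := by
  simpa [psiSeq] using card_nsmul_le_sum (Icc 1 T) τ (τ S) fun t ht =>
    hτ.antitoneOn (mem_Icc.1 ht).1 ((mem_Icc.1 ht).1.trans ((mem_Icc.1 ht).2.trans h))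
      ((mem_Icc.1 ht).2.trans h)

theorem psiSeq_le (hτ : ThresholdSequence τ) (T : ℕ) : psiSeq τ T ≤ T := by
  simpa [psiSeq, hτ.one_eq_one] using sum_le_card_nsmul (Icc 1 T) τ (τ 1) fun t ht =>
    hτ.antitoneOn (Set.mem_Ici.2 le_rfl) (mem_Icc.1 ht).1 (mem_Icc.1 ht).1

theorem one_le_sqrt_mul_psiSeq (hτ : ThresholdSequence τ) (hT : 1 ≤ T) :
    1 ≤ √(T * psiSeq τ T) :=
  Real.one_le_sqrt.2
    (one_le_mul_of_one_le_of_one_le (Nat.one_le_cast.2 hT) (hτ.one_le_psiSeq hT))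

theorem psiSeq_le_sqrt (hτ : ThresholdSequence τ) (hT : 1 ≤ T) :
    psiSeq τ T ≤ √(T * psiSeq τ T) := by
  have hΨ := zero_le_one.trans (hτ.one_le_psiSeq hT)
  refine Real.le_sqrt_of_sq_le ?_
  rw [sq]
  exact mul_le_mul_of_nonneg_right (hτ.psiSeq_le T) hΨ

theorem sqrt_mul_psiSeq_le (hτ : ThresholdSequence τ) (T : ℕ) : √(T * psiSeq τ T) ≤ T := by
  refine Real.sqrt_le_iff.2 ⟨Nat.cast_nonneg _, ?_⟩
  rw [sq]
  exact mul_le_mul_of_nonneg_left (hτ.psiSeq_le T) (Nat.cast_nonneg _)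

theorem sqrt_div_psiSeq_le (hτ : ThresholdSequence τ) (hT : 1 ≤ T) :
    √(T / psiSeq τ T) ≤ √(T * psiSeq τ T) := by
  have hΨ := hτ.one_le_psiSeq hT
  rw [← mul_sqrt_div_self (zero_le_one.trans hΨ)]
  exact le_mul_of_one_le_left (Real.sqrt_nonneg _) hΨ

theorem alphaSeq_antitoneOn (hτ : ThresholdSequence τ) :
    AntitoneOn (alphaSeq τ) (Set.Ici 1) := by
  refine antitoneOn_nat_Ici_of_succ_le fun t ht => Real.sqrt_le_sqrt ?_
  have ht₀ : (0 : ℝ) < t := Nat.cast_pos.2 ht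
  have hlast := hτ.mul_le_psiSeq (Nat.le_succ t)
  have hsucc : psiSeq τ (t + 1) = psiSeq τ t + τ (t + 1) :=
    sum_Icc_succ_top (Nat.le_add_left 1 t) τ
  rw [hsucc, div_le_div_iff₀ (by positivity) ht₀, Nat.cast_succ]
  linarith

theorem stepSizes (hτ : ThresholdSequence τ) (hκ : 0 ≤ κ) :
    StepSizes (alphaSeq τ) (betaSeq κ) (gammaSeq κ) τ where
  β_pos t ht := one_div_pos.2 (Real.rpow_pos_of_pos (Nat.cast_pos.2 ht) _)
  β_succ_le t ht := antitoneOn_one_div_rpow hκ ht (Nat.le_add_left 1 t) (Nat.le_succ t)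
  γ_pos t ht := one_div_pos.2 (Real.rpow_pos_of_pos (Nat.cast_pos.2 ht) _)
  β_mul_γ_le_one t ht := by
    rw [betaSeq, gammaSeq, div_mul_div_comm, ← Real.rpow_add (Nat.cast_pos.2 ht),
      add_sub_cancel, Real.rpow_one, one_mul]
    exact div_le_one_of_le₀ (Nat.one_le_cast.2 ht) (Nat.cast_nonneg t)
  inv_γ_succ_sub_β_le t ht := by
    have hinv : ∀ s ≥ 1, (gammaSeq κ s)⁻¹ = s * betaSeq κ s := fun s hs => by
      rw [gammaSeq, betaSeq, one_div, inv_inv, Real.rpow_sub (Nat.cast_pos.2 hs), Real.rpow_one,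
        mul_one_div]
    have hβ : betaSeq κ (t + 1) ≤ betaSeq κ t :=
      antitoneOn_one_div_rpow hκ ht (Nat.le_add_left 1 t) (Nat.le_succ t)
    rw [hinv t ht, hinv (t + 1) (Nat.le_add_left 1 t), Nat.cast_succ]
    linarith [mul_le_mul_of_nonneg_left hβ (Nat.cast_nonneg t)]
  α_pos t ht := Real.sqrt_pos.2
    (div_pos (zero_lt_one.trans_le (hτ.one_le_psiSeq ht)) (Nat.cast_pos.2 ht))
  α_anti := hτ.alphaSeq_antitoneOn
  τ_nonneg t ht := (hτ.pos t ht).le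

theorem inv_alphaSeq_succ_le (hτ : ThresholdSequence τ) (hT : 1 ≤ T) :
    (alphaSeq τ (T + 1))⁻¹ ≤ 2 * √(T / psiSeq τ T) := by
  have hT₁ : (1 : ℝ) ≤ T := Nat.one_le_cast.2 hT
  have hΨ := zero_lt_one.trans_le (hτ.one_le_psiSeq hT)
  have hΨ_le := hτ.psiSeq_mono (Nat.le_succ T)
  calc (alphaSeq τ (T + 1))⁻¹ = √((T + 1 : ℕ) / psiSeq τ (T + 1)) := by
        rw [alphaSeq, ← Real.sqrt_inv, inv_div]
    _ ≤ √(2 ^ 2 * (T / psiSeq τ T)) := by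
        rw [← mul_div_assoc, Nat.cast_succ]
        gcongr
        linarith
    _ = 2 * √(T / psiSeq τ T) := by rw [Real.sqrt_mul (by norm_num), Real.sqrt_sq zero_le_two]

theorem sum_alphaSeq_le (hτ : ThresholdSequence τ) (T : ℕ) :
    ∑ t ∈ Icc 1 T, alphaSeq τ (t + 1) ≤ 2 * √(T * psiSeq τ T) := by
  calc ∑ t ∈ Icc 1 T, alphaSeq τ (t + 1)
      ≤ ∑ t ∈ Icc 1 T, √(psiSeq τ T) * (1 / (t : ℝ) ^ (1 / 2 : ℝ)) := by
        refine sum_le_sum fun t ht => ?_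
        obtain ⟨ht₁, htT⟩ := mem_Icc.1 ht
        refine (hτ.alphaSeq_antitoneOn ht₁ (Nat.le_add_left 1 t) (Nat.le_succ t)).trans ?_
        rw [alphaSeq, Real.sqrt_div' _ (Nat.cast_nonneg _), ← Real.sqrt_eq_rpow, mul_one_div]
        gcongr
        exact hτ.psiSeq_mono htT
    _ ≤ √(psiSeq τ T) * ((T : ℝ) ^ (1 - 1 / 2 : ℝ) / (1 - 1 / 2)) := by
        rw [← mul_sum]
        gcongr
        exact sum_Icc_one_div_rpow_le (by norm_num) (by norm_num) T
    _ = 2 * √(T * psiSeq τ T) := by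
        rw [Real.sqrt_mul (Nat.cast_nonneg _), Real.sqrt_eq_rpow (T : ℝ), sub_half]
        ring

end ThresholdSequence

section Bounds

variable {n p : ℕ} {m : Fin n → ℕ} {X : Set (Vec p)} {f : Fin n → ℕ → Vec p → ℝ}
  {g : (i : Fin n) → ℕ → Vec p → Vec (m i)} {R F₁ F₂ w κ : ℝ} {B : ℕ} {G : ℕ → Digraph (Fin n)}
  {W : ℕ → Matrix (Fin n) (Fin n) ℝ} {α β γ τ : ℕ → ℝ} {s : Trajectory n p m}

/-- The growth of the regret over a horizon `T` in terms of the accumulated threshold `Ψ` and the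
path length `P` of the comparator. -/
noncomputable def regretRate (κ Ψ P T : ℝ) : ℝ := T ^ κ + √(T * Ψ) + √(T / Ψ) * P

/-- The growth of the constraint violation over a horizon `T` in terms of the accumulated
threshold `Ψ`. -/
noncomputable def violationRate (κ Ψ T : ℝ) : ℝ := T ^ (1 - κ / 2) + (T ^ 3 * Ψ) ^ (1 / 4 : ℝ)

/-- The constant in front of the rates, uniform over all instances of the problem. -/
noncomputable def rateConst (m : Fin n → ℕ) (B : ℕ) (w R F₁ F₂ κ : ℝ) : ℝ :=
  n * (4 * R ^ 2) + n * (6 * R) + 4 * couplingConst m B w R F₂ +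
    n * (2 * couplingConst m B w R F₂ ^ 2) +
    n * (constraintScale m ^ 2 / 2 * (1 + 1 / (1 - κ))) +
    n * (2 * (F₁ + F₂ * (2 * R)) ^ 2 / κ)

theorem rateConst_nonneg (m : Fin n → ℕ) (B : ℕ) (F₁ : ℝ) (hw : 0 < w) (hR : 0 ≤ R)
    (hF₂ : 0 ≤ F₂) (hκ₀ : 0 < κ) (hκ₁ : κ < 1) : 0 ≤ rateConst m B w R F₁ F₂ κ := by
  have hk := couplingConst_nonneg m B hw hR hF₂
  have := sub_pos.2 hκ₁
  unfold rateConst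
  positivity

theorem sum_betaSeq_succ_le (hκ₀ : 0 ≤ κ) (hκ₁ : κ < 1) (T : ℕ) :
    ∑ t ∈ Icc 1 T, betaSeq κ (t + 1) ≤ (T : ℝ) ^ (1 - κ) / (1 - κ) :=
  sum_one_div_succ_rpow_le hκ₀ hκ₁ T

theorem sum_gammaSeq_succ_le (hκ₀ : 0 < κ) (hκ₁ : κ ≤ 1) (T : ℕ) :
    ∑ t ∈ Icc 1 T, gammaSeq κ (t + 1) ≤ (T : ℝ) ^ κ / κ := by
  simpa [gammaSeq] using sum_one_div_succ_rpow_le (sub_nonneg.2 hκ₁) (sub_lt_self 1 hκ₀) T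

theorem inv_gammaSeq_one_add_sum_le (hκ₀ : 0 ≤ κ) (hκ₁ : κ < 1) {T : ℕ} (hT : 1 ≤ T) :
    (gammaSeq κ 1)⁻¹ + ∑ t ∈ Icc 1 T, betaSeq κ (t + 1) ≤
      (1 + 1 / (1 - κ)) * (T : ℝ) ^ (1 - κ) := by
  have hfirst : (gammaSeq κ 1)⁻¹ ≤ (T : ℝ) ^ (1 - κ) := by
    simpa [gammaSeq] using Real.one_le_rpow (Nat.one_le_cast.2 hT) (sub_nonneg.2 hκ₁.le)
  rw [one_add_mul, one_div_mul_eq_div]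
  exact add_le_add hfirst (sum_betaSeq_succ_le hκ₀ hκ₁ T)

namespace ThresholdSequence

theorem psiSeq_div_alphaSeq_succ_le (hτ : ThresholdSequence τ) {T : ℕ} (hT : 1 ≤ T) :
    psiSeq τ T / alphaSeq τ (T + 1) ≤ 2 * √(T * psiSeq τ T) := by
  have hΨ := zero_le_one.trans (hτ.one_le_psiSeq hT)
  rw [← mul_sqrt_div_self hΨ, mul_left_comm, div_eq_mul_inv]
  exact mul_le_mul_of_nonneg_left (hτ.inv_alphaSeq_succ_le hT) hΨ

theorem one_add_mul_one_add_psiSeq_le (hτ : ThresholdSequence τ) (r : ℝ) {T : ℕ} (hT : 1 ≤ T) :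
    (1 + r) * (1 + psiSeq τ T) ≤ 4 * ((1 + r ^ 2) * √(T * psiSeq τ T)) := by
  have hΨ := hτ.one_le_psiSeq hT
  have hr : 1 + r ≤ 2 * (1 + r ^ 2) := by nlinarith [sq_nonneg (r - 1)]
  calc (1 + r) * (1 + psiSeq τ T) ≤ 2 * (1 + r ^ 2) * (1 + psiSeq τ T) := by gcongr
    _ ≤ 2 * (1 + r ^ 2) * (√(T * psiSeq τ T) + √(T * psiSeq τ T)) := by
        gcongr
        exacts [hτ.one_le_sqrt_mul_psiSeq hT, hτ.psiSeq_le_sqrt hT]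
    _ = 4 * ((1 + r ^ 2) * √(T * psiSeq τ T)) := by ring

theorem one_add_sq_mul_sum_alphaSeq_le (hτ : ThresholdSequence τ) (r : ℝ) (T : ℕ) :
    (1 + r) ^ 2 * ∑ t ∈ Icc 1 T, alphaSeq τ (t + 1) ≤
      4 * ((1 + r ^ 2) * √(T * psiSeq τ T)) := by
  have hr : (1 + r) ^ 2 ≤ 2 * (1 + r ^ 2) := by nlinarith [sq_nonneg (r - 1)]
  calc (1 + r) ^ 2 * ∑ t ∈ Icc 1 T, alphaSeq τ (t + 1)
      ≤ 2 * (1 + r ^ 2) * (2 * √(T * psiSeq τ T)) :=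
        mul_le_mul hr (hτ.sum_alphaSeq_le T) (sum_nonneg fun _ _ => Real.sqrt_nonneg _)
          (by positivity)
    _ = 4 * ((1 + r ^ 2) * √(T * psiSeq τ T)) := by ring

end ThresholdSequence

theorem pathLength_nonneg (y : ℕ → Vec p) (T : ℕ) : 0 ≤ pathLength y T :=
  sum_nonneg fun _ _ => norm_nonneg _

theorem Generated.lagrangian_le_rateConst_mul (h : Generated X f g F₂ W α β γ τ s)
    (hP : ConvexProblem X f g R F₁ F₂) (hW : MixingNetwork G W w B) (hS : StepSizes α β γ τ)
    (hn : 0 < n) (hw : 0 < w) (hR : 0 ≤ R) (hF₂ : 0 ≤ F₂) {r : ℝ} (hr : 0 ≤ r) {T : ℕ}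
    (hT : 1 ≤ T) {y : ℕ → Vec p} (hy : y ∈ feasibleSeqs X g T) {Λ : ℝ}
    (hinit : (α (T + 1))⁻¹ ≤ 2 * Λ) (hpath : pathLength y T / α T ≤ Λ)
    (htrigger : psiSeq τ T / α (T + 1) ≤ 2 * Λ) (hcoupling : (1 + r) * (1 + psiSeq τ T) ≤ 4 * Λ)
    (hα : (1 + r) ^ 2 * ∑ t ∈ Icc 1 T, α (t + 1) ≤ 4 * Λ)
    (hβ : r ^ 2 * ((γ 1)⁻¹ + ∑ t ∈ Icc 1 T, β (t + 1)) ≤ (1 + 1 / (1 - κ)) * Λ)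
    (hγ : ∑ t ∈ Icc 1 T, γ (t + 1) ≤ Λ / κ) :
    n * netReg f s.x y T + r * netCCV g s.x T ≤ rateConst m B w R F₁ F₂ κ * Λ := by
  set k := couplingConst m B w R F₂
  have hk : 0 ≤ k := couplingConst_nonneg m B hw hR hF₂
  refine (h.lagrangian_le hP hW hS hn hw hR hF₂ hr hT hy).trans ?_
  calc _ = n * (2 * R ^ 2) * (α (T + 1))⁻¹ +
        n * (2 * R) * (pathLength y T / α T) +
        n * (2 * R) * (psiSeq τ T / α (T + 1)) +
        k * ((1 + r) * (1 + psiSeq τ T)) +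
        n * (k ^ 2 / 2) * ((1 + r) ^ 2 * ∑ t ∈ Icc 1 T, α (t + 1)) +
        n * (constraintScale m ^ 2 / 2) *
          (r ^ 2 * ((γ 1)⁻¹ + ∑ t ∈ Icc 1 T, β (t + 1))) +
        n * (2 * (F₁ + F₂ * (2 * R)) ^ 2) * ∑ t ∈ Icc 1 T, γ (t + 1) := by ring
    _ ≤ n * (2 * R ^ 2) * (2 * Λ) + n * (2 * R) * Λ + n * (2 * R) * (2 * Λ) + k * (4 * Λ) +
        n * (k ^ 2 / 2) * (4 * Λ) + n * (constraintScale m ^ 2 / 2) * ((1 + 1 / (1 - κ)) * Λ) +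
        n * (2 * (F₁ + F₂ * (2 * R)) ^ 2) * (Λ / κ) := by gcongr
    _ = rateConst m B w R F₁ F₂ κ * Λ := by
        rw [rateConst]
        ring

theorem Generated.lagrangian_le_rate
    (h : Generated X f g F₂ W (alphaSeq τ) (betaSeq κ) (gammaSeq κ) τ s)
    (hP : ConvexProblem X f g R F₁ F₂) (hW : MixingNetwork G W w B) (hτ : ThresholdSequence τ)
    (hn : 0 < n) (hw : 0 < w) (hR : 0 ≤ R) (hF₂ : 0 ≤ F₂) (hκ₀ : 0 < κ) (hκ₁ : κ < 1) {r : ℝ}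
    (hr : 0 ≤ r) {T : ℕ} (hT : 1 ≤ T) {y : ℕ → Vec p} (hy : y ∈ feasibleSeqs X g T) :
    n * netReg f s.x y T + r * netCCV g s.x T ≤
      rateConst m B w R F₁ F₂ κ * (regretRate κ (psiSeq τ T) (pathLength y T) T +
        r ^ 2 * ((T : ℝ) ^ (1 - κ) + √(T * psiSeq τ T))) := by
  set Λ := regretRate κ (psiSeq τ T) (pathLength y T) T +
    r ^ 2 * ((T : ℝ) ^ (1 - κ) + √(T * psiSeq τ T)) with hΛ
  rw [regretRate] at hΛ
  have hZ : 0 ≤ (T : ℝ) ^ κ := by positivity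
  have hA : 0 ≤ r ^ 2 * (T : ℝ) ^ (1 - κ) := by positivity
  have hrS : 0 ≤ r ^ 2 * √(T * psiSeq τ T) := by positivity
  have hQ : 0 ≤ √(T / psiSeq τ T) * pathLength y T :=
    mul_nonneg (Real.sqrt_nonneg _) (pathLength_nonneg y T)
  have hS := Real.sqrt_nonneg (T * psiSeq τ T)
  have hinit : (alphaSeq τ (T + 1))⁻¹ ≤ 2 * Λ := by
    linarith [hτ.inv_alphaSeq_succ_le hT, hτ.sqrt_div_psiSeq_le hT]
  have hpath : pathLength y T / alphaSeq τ T ≤ Λ := by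
    rw [div_eq_inv_mul, alphaSeq, ← Real.sqrt_inv, inv_div]
    linarith
  have htrigger : psiSeq τ T / alphaSeq τ (T + 1) ≤ 2 * Λ := by
    linarith [hτ.psiSeq_div_alphaSeq_succ_le hT]
  have hcoupling : (1 + r) * (1 + psiSeq τ T) ≤ 4 * Λ := by
    linarith [hτ.one_add_mul_one_add_psiSeq_le r hT]
  have hα : (1 + r) ^ 2 * ∑ t ∈ Icc 1 T, alphaSeq τ (t + 1) ≤ 4 * Λ := by
    linarith [hτ.one_add_sq_mul_sum_alphaSeq_le r T]
  have hβ : r ^ 2 * ((gammaSeq κ 1)⁻¹ + ∑ t ∈ Icc 1 T, betaSeq κ (t + 1)) ≤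
      (1 + 1 / (1 - κ)) * Λ := by
    have := sub_pos.2 hκ₁
    refine (mul_le_mul_of_nonneg_left (inv_gammaSeq_one_add_sum_le hκ₀.le hκ₁ hT)
      (sq_nonneg r)).trans ?_
    rw [mul_left_comm]
    gcongr
    linarith
  have hγ : ∑ t ∈ Icc 1 T, gammaSeq κ (t + 1) ≤ Λ / κ :=
    (sum_gammaSeq_succ_le hκ₀ hκ₁.le T).trans (by gcongr; linarith)
  exact h.lagrangian_le_rateConst_mul hP hW (hτ.stepSizes hκ₀.le) hn hw hR hF₂ hr hT hy hinit
    hpath htrigger hcoupling hα hβ hγ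

end Bounds

section Performance

variable {n p : ℕ} {m : Fin n → ℕ} {X : Set (Vec p)} {f : Fin n → ℕ → Vec p → ℝ}
  {g : (i : Fin n) → ℕ → Vec p → Vec (m i)} {R F₁ F₂ w κ : ℝ} {B : ℕ} {G : ℕ → Digraph (Fin n)}
  {W : ℕ → Matrix (Fin n) (Fin n) ℝ} {α β γ τ : ℕ → ℝ} {s : Trajectory n p m}

theorem Generated.netReg_le
    (h : Generated X f g F₂ W (alphaSeq τ) (betaSeq κ) (gammaSeq κ) τ s)
    (hP : ConvexProblem X f g R F₁ F₂) (hW : MixingNetwork G W w B) (hτ : ThresholdSequence τ)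
    (hn : 0 < n) (hw : 0 < w) (hR : 0 ≤ R) (hF₂ : 0 ≤ F₂) (hκ₀ : 0 < κ) (hκ₁ : κ < 1) {T : ℕ}
    (hT : 1 ≤ T) {y : ℕ → Vec p} (hy : y ∈ feasibleSeqs X g T) :
    netReg f s.x y T ≤
      rateConst m B w R F₁ F₂ κ / n * regretRate κ (psiSeq τ T) (pathLength y T) T := by
  have hbound := h.lagrangian_le_rate hP hW hτ hn hw hR hF₂ hκ₀ hκ₁ le_rfl hT hy
  rw [div_mul_eq_mul_div, le_div_iff₀ (Nat.cast_pos.2 hn)]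
  linarith

theorem ConvexProblem.globalLoss_le_add (hP : ConvexProblem X f g R F₁ F₂) (hn : 0 < n) {t : ℕ}
    (ht : 1 ≤ t) {x y : Vec p} (hx : x ∈ X) (hy : y ∈ X) :
    globalLoss f t y ≤ globalLoss f t x + F₁ := by
  have hn₀ : (0 : ℝ) < n := Nat.cast_pos.2 hn
  have hsum : ∑ j, f j t y ≤ ∑ j, (f j t x + F₁) := sum_le_sum fun j _ => by
    linarith [(abs_le.1 (hP.loss_variation j t ht x hx y hy)).1]
  rw [sum_add_distrib, sum_const, card_univ, Fintype.card_fin, nsmul_eq_mul] at hsum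
  rw [globalLoss, globalLoss, one_div, inv_mul_eq_div, inv_mul_eq_div, div_add' _ _ _ hn₀.ne']
  gcongr
  linarith

theorem Generated.neg_mul_le_netReg (h : Generated X f g F₂ W α β γ τ s)
    (hP : ConvexProblem X f g R F₁ F₂) (hn : 0 < n) {T : ℕ} {y : ℕ → Vec p}
    (hy : ∀ t ∈ Icc 1 T, y t ∈ X) : -(F₁ * T) ≤ netReg f s.x y T := by
  have hn₀ : (0 : ℝ) < n := Nat.cast_pos.2 hn
  have hagent : ∀ i, ∑ t ∈ Icc 1 T, globalLoss f t (y t) ≤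
      ∑ t ∈ Icc 1 T, globalLoss f t (s.x i t) + F₁ * T := fun i => by
    calc ∑ t ∈ Icc 1 T, globalLoss f t (y t) ≤ ∑ t ∈ Icc 1 T, (globalLoss f t (s.x i t) + F₁) :=
          sum_le_sum fun t ht => hP.globalLoss_le_add hn (mem_Icc.1 ht).1
            (h.x_mem i (mem_Icc.1 ht).1) (hy t ht)
      _ = _ := by simp [sum_add_distrib, mul_comm]
  have hsum := sum_le_sum fun i (_ : i ∈ univ) => hagent i
  rw [sum_add_distrib, sum_const, sum_const, card_univ, Fintype.card_fin, nsmul_eq_mul,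
    nsmul_eq_mul, ← le_div_iff₀' hn₀, add_div, mul_div_cancel_left₀ _ hn₀.ne'] at hsum
  rw [netReg, one_div_mul_eq_div]
  linarith

-- The multiplier `r = √(T / A)` makes the two error terms `T` and `r ^ 2 * A` equal.
theorem le_mul_sqrt_of_balance {v a T A : ℝ} (hT : 0 < T) (hA : 0 < A)
    (h : ∀ r, 0 < r → r ^ 2 * A = T → r * v ≤ a * T) : v ≤ a * √(T * A) := by
  have hr : 0 < √(T / A) := Real.sqrt_pos.2 (by positivity)
  have hrT : √(T / A) * √(T * A) = T := by
    have hsq : T / A * (T * A) = T ^ 2 := by field_simp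
    rw [← Real.sqrt_mul (by positivity), hsq, Real.sqrt_sq hT.le]
  refine le_of_mul_le_mul_left ?_ hr
  rw [mul_left_comm, hrT]
  exact h _ hr (by rw [Real.sq_sqrt (by positivity), div_mul_cancel₀ _ hA.ne'])

theorem sqrt_mul_le_violationRate {κ Ψ T : ℝ} (hκ : κ < 2) (hΨ : 0 ≤ Ψ) (hT : 0 < T) :
    √(T * (T ^ (1 - κ) + √(T * Ψ))) ≤ violationRate κ Ψ T := by
  have hdual : √(T * T ^ (1 - κ)) = T ^ (1 - κ / 2) := by
    rw [Real.sqrt_eq_rpow, ← Real.rpow_one_add' hT.le (by linarith), ← Real.rpow_mul hT.le]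
    ring_nf
  have hprimal : √(T * √(T * Ψ)) = (T ^ 3 * Ψ) ^ (1 / 4 : ℝ) := by
    rw [← Real.sqrt_sq hT.le, ← Real.sqrt_mul (sq_nonneg _), Real.sqrt_sq hT.le,
      Real.sqrt_eq_rpow, Real.sqrt_eq_rpow, ← Real.rpow_mul (by positivity)]
    ring_nf
  rw [violationRate, mul_add, ← hdual, ← hprimal]
  simpa only [Real.sqrt_eq_rpow] using Real.rpow_add_le_add_rpow (by positivity) (by positivity)
    one_half_pos.le one_half_lt_one.le

theorem Generated.netCCV_le_violationRate
    (h : Generated X f g F₂ W (alphaSeq τ) (betaSeq κ) (gammaSeq κ) τ s)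
    (hP : ConvexProblem X f g R F₁ F₂) (hW : MixingNetwork G W w B) (hτ : ThresholdSequence τ)
    (hn : 0 < n) (hw : 0 < w) (hR : 0 ≤ R) (hF₁ : 0 ≤ F₁) (hF₂ : 0 ≤ F₂) (hκ₀ : 0 < κ)
    (hκ₁ : κ < 1) {T : ℕ} (hT : 1 ≤ T) (hX : (feasibleStatic X g T).Nonempty) :
    netCCV g s.x T ≤
      (n * F₁ + 3 * rateConst m B w R F₁ F₂ κ) * violationRate κ (psiSeq τ T) T := by
  obtain ⟨y, hy⟩ := hX
  have hK := rateConst_nonneg m B F₁ hw hR hF₂ hκ₀ hκ₁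
  have hT₁ : (1 : ℝ) ≤ T := Nat.one_le_cast.2 hT
  have hT₀ : (0 : ℝ) < T := zero_lt_one.trans_le hT₁
  have hΨ : 0 ≤ psiSeq τ T := zero_le_one.trans (hτ.one_le_psiSeq hT)
  refine le_trans (le_mul_sqrt_of_balance hT₀ (by positivity) fun r hr hbalance => ?_)
    (mul_le_mul_of_nonneg_left (sqrt_mul_le_violationRate (by linarith) hΨ hT₀) (by positivity))
  have hbound := h.lagrangian_le_rate hP hW hτ hn hw hR hF₂ hκ₀ hκ₁ hr.le hT hy
  have hrate : regretRate κ (psiSeq τ T) (pathLength (fun _ => y) T) T ≤ 2 * T := by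
    have hZ : (T : ℝ) ^ κ ≤ T := by simpa using Real.rpow_le_rpow_of_exponent_le hT₁ hκ₁.le
    have hpath : pathLength (fun _ => y) T = 0 := by simp [pathLength]
    rw [regretRate, hpath]
    linarith [hτ.sqrt_mul_psiSeq_le T]
  have hlower := mul_le_mul_of_nonneg_left
    (h.neg_mul_le_netReg hP hn fun t ht => (hy t ht).1) (Nat.cast_nonneg (α := ℝ) n)
  rw [hbalance] at hbound
  linarith [mul_le_mul_of_nonneg_left hrate hK]

end Performance

section Regimes

variable {κ Ψ L P T c : ℝ}

theorem regretRate_nonneg (hP : 0 ≤ P) (hT : 0 ≤ T) : 0 ≤ regretRate κ Ψ P T := by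
  unfold regretRate
  positivity

theorem violationRate_nonneg (hΨ : 0 ≤ Ψ) (hT : 0 ≤ T) : 0 ≤ violationRate κ Ψ T := by
  unfold violationRate
  positivity

theorem regretRate_le_mul (hc : 1 ≤ c) (hL : 0 < L) (hLΨ : L ≤ Ψ) (hΨ : Ψ ≤ c * L) (hP : 0 ≤ P)
    (hT : 0 ≤ T) : regretRate κ Ψ P T ≤ c * regretRate κ L P T := by
  have hsqrt : √(T * Ψ) ≤ c * √(T * L) := by
    rw [← Real.sqrt_sq (zero_le_one.trans hc), ← Real.sqrt_mul (sq_nonneg c)]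
    refine Real.sqrt_le_sqrt ?_
    calc T * Ψ ≤ T * (c * L) := by gcongr
      _ = c * (T * L) := by ring
      _ ≤ c ^ 2 * (T * L) := by
        gcongr
        exact le_self_pow₀ hc two_ne_zero
  have hsqrt_div : √(T / Ψ) * P ≤ √(T / L) * P := by gcongr
  unfold regretRate
  rw [mul_add, mul_add]
  refine add_le_add (add_le_add ?_ hsqrt) (hsqrt_div.trans ?_)
  · exact le_mul_of_one_le_left (by positivity) hc
  · exact le_mul_of_one_le_left (by positivity) hc

theorem violationRate_le_mul (hc : 1 ≤ c) (hΨ₀ : 0 ≤ Ψ) (hL : 0 ≤ L) (hΨ : Ψ ≤ c * L)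
    (hT : 0 ≤ T) : violationRate κ Ψ T ≤ c * violationRate κ L T := by
  have hc₀ : 0 ≤ c := zero_le_one.trans hc
  unfold violationRate
  rw [mul_add]
  refine add_le_add (le_mul_of_one_le_left (by positivity) hc) ?_
  calc (T ^ 3 * Ψ) ^ (1 / 4 : ℝ) ≤ (c * (T ^ 3 * L)) ^ (1 / 4 : ℝ) := by
        refine Real.rpow_le_rpow (by positivity) ?_ (by norm_num)
        rw [mul_left_comm]
        gcongr
    _ = c ^ (1 / 4 : ℝ) * (T ^ 3 * L) ^ (1 / 4 : ℝ) := Real.mul_rpow hc₀ (by positivity)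
    _ ≤ c * (T ^ 3 * L) ^ (1 / 4 : ℝ) := by
        gcongr
        exact Real.rpow_le_self_of_one_le hc (by norm_num)

theorem rpow_add_rpow_le_two_mul_rpow_max (hT : 1 ≤ T) (a b : ℝ) :
    T ^ a + T ^ b ≤ 2 * T ^ max a b := by
  rw [two_mul]
  exact add_le_add (Real.rpow_le_rpow_of_exponent_le hT (le_max_left a b))
    (Real.rpow_le_rpow_of_exponent_le hT (le_max_right a b))

theorem regretRate_rpow_le (κ e : ℝ) (hP : 0 ≤ P) (hT : 1 ≤ T) :
    regretRate κ (T ^ e) P T ≤ 2 * (T ^ max κ ((1 + e) / 2) + T ^ ((1 - e) / 2) * P) := by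
  have hT₀ : 0 < T := zero_lt_one.trans_le hT
  have hmul : √(T * T ^ e) = T ^ ((1 + e) / 2) := by
    have hexp : T * T ^ e = T ^ (1 + e) := by rw [Real.rpow_add hT₀, Real.rpow_one]
    rw [hexp, Real.sqrt_eq_rpow, ← Real.rpow_mul hT₀.le, mul_one_div]
  have hdiv : √(T / T ^ e) = T ^ ((1 - e) / 2) := by
    have hexp : T / T ^ e = T ^ (1 - e) := by rw [Real.rpow_sub hT₀, Real.rpow_one]
    rw [hexp, Real.sqrt_eq_rpow, ← Real.rpow_mul hT₀.le, mul_one_div]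
  rw [regretRate, hmul, hdiv, mul_add]
  have hpath : 0 ≤ T ^ ((1 - e) / 2) * P := by positivity
  linarith [rpow_add_rpow_le_two_mul_rpow_max hT κ ((1 + e) / 2)]

theorem regretRate_le_of_rpow_le {e : ℝ} (hc : 1 ≤ c) (hΨ : T ^ e ≤ Ψ) (hΨc : Ψ ≤ c * T ^ e)
    (hP : 0 ≤ P) (hT : 1 ≤ T) :
    regretRate κ Ψ P T ≤ 2 * c * (T ^ max κ ((1 + e) / 2) + T ^ ((1 - e) / 2) * P) := by
  have hT₀ : 0 < T := zero_lt_one.trans_le hT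
  rw [mul_comm 2 c, mul_assoc]
  exact (regretRate_le_mul hc (Real.rpow_pos_of_pos hT₀ e) hΨ hΨc hP hT₀.le).trans
    (mul_le_mul_of_nonneg_left (regretRate_rpow_le κ e hP hT) (zero_le_one.trans hc))

theorem violationRate_rpow_le (κ e : ℝ) (hT : 1 ≤ T) :
    violationRate κ (T ^ e) T ≤ 2 * T ^ max (1 - κ / 2) ((3 + e) / 4) := by
  have hT₀ : 0 < T := zero_lt_one.trans_le hT
  have hquarter : (T ^ 3 * T ^ e) ^ (1 / 4 : ℝ) = T ^ ((3 + e) / 4) := by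
    rw [← Real.rpow_natCast, ← Real.rpow_add hT₀, ← Real.rpow_mul hT₀.le, mul_one_div,
      Nat.cast_ofNat]
  rw [violationRate, hquarter]
  exact rpow_add_rpow_le_two_mul_rpow_max hT _ _

theorem violationRate_le_of_le_rpow {e : ℝ} (hc : 1 ≤ c) (hΨ : 0 ≤ Ψ) (hΨc : Ψ ≤ c * T ^ e)
    (hT : 1 ≤ T) : violationRate κ Ψ T ≤ 2 * c * T ^ max (1 - κ / 2) ((3 + e) / 4) := by
  have hT₀ : 0 ≤ T := zero_le_one.trans hT
  rw [mul_comm 2 c, mul_assoc]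
  exact (violationRate_le_mul hc hΨ (Real.rpow_nonneg hT₀ e) hΨc hT₀).trans
    (mul_le_mul_of_nonneg_left (violationRate_rpow_le κ e hT) (zero_le_one.trans hc))

end Regimes

section PowerThresholds

variable {θ : ℝ} {T : ℕ}

theorem thresholdSequence_tauSeq (hθ : 0 ≤ θ) : ThresholdSequence (tauSeq θ) where
  pos _ ht := one_div_pos.2 (Real.rpow_pos_of_pos (Nat.cast_pos.2 ht) θ)
  antitoneOn := antitoneOn_one_div_rpow hθ
  one_eq_one := by simp [tauSeq]

theorem rpow_le_psiSeq_tauSeq (hθ : 0 ≤ θ) (hT : 1 ≤ T) :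
    (T : ℝ) ^ (1 - θ) ≤ psiSeq (tauSeq θ) T := by
  refine le_trans (le_of_eq ?_) ((thresholdSequence_tauSeq hθ).mul_le_psiSeq le_rfl)
  rw [tauSeq, Real.rpow_sub (Nat.cast_pos.2 hT), Real.rpow_one, mul_one_div]

theorem psiSeq_tauSeq_le_of_lt_one (hθ₀ : 0 ≤ θ) (hθ₁ : θ < 1) (T : ℕ) :
    psiSeq (tauSeq θ) T ≤ 1 / (1 - θ) * (T : ℝ) ^ (1 - θ) := by
  rw [one_div_mul_eq_div]
  exact sum_Icc_one_div_rpow_le hθ₀ hθ₁ T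

theorem psiSeq_tauSeq_le_tsum (hθ : 1 < θ) (T : ℕ) :
    psiSeq (tauSeq θ) T ≤ ∑' t, tauSeq θ t :=
  (Real.summable_one_div_nat_rpow.2 hθ).sum_le_tsum _ fun t _ =>
    one_div_nonneg.2 (Real.rpow_nonneg t.cast_nonneg θ)

theorem psiSeq_tauSeq_one (T : ℕ) : psiSeq (tauSeq 1) T = harmonic T := by
  simp [psiSeq, tauSeq, harmonic_eq_sum_Icc]

theorem log_le_psiSeq_tauSeq_one (hT : 1 ≤ T) : Real.log T ≤ psiSeq (tauSeq 1) T := by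
  rw [psiSeq_tauSeq_one]
  refine le_trans ?_ (log_add_one_le_harmonic T)
  exact Real.log_le_log (Nat.cast_pos.2 hT) (Nat.cast_le.2 T.le_succ)

theorem psiSeq_tauSeq_one_le (hT : 2 ≤ T) : psiSeq (tauSeq 1) T ≤ 3 * Real.log T := by
  have hlog : Real.log 2 ≤ Real.log T := Real.log_le_log two_pos (Nat.ofNat_le_cast.2 hT)
  rw [psiSeq_tauSeq_one]
  linarith [harmonic_le_one_add_log T, Real.log_two_gt_d9]

end PowerThresholds

section Rates

variable {κ θ P : ℝ} {T : ℕ}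

/-- The factor by which the accumulated thresholds `1 / t ^ θ` may exceed their growth rate, which
is `T ^ (1 - θ)`, `log T` or `1` according to the position of `θ` relative to `1`. Only the entry
of the maximum that matches the regime of `θ` is meaningful. -/
noncomputable def growthConst (θ : ℝ) : ℝ := max 3 (max (1 / (1 - θ)) (∑' t, tauSeq θ t))

theorem three_le_growthConst (θ : ℝ) : 3 ≤ growthConst θ := le_max_left _ _

theorem one_le_growthConst (θ : ℝ) : 1 ≤ growthConst θ := by
  linarith [three_le_growthConst θ]

theorem psiSeq_tauSeq_le_growthConst_mul_rpow (hθ₀ : 0 ≤ θ) (hθ₁ : θ < 1) (T : ℕ) :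
    psiSeq (tauSeq θ) T ≤ growthConst θ * (T : ℝ) ^ (1 - θ) := by
  refine (psiSeq_tauSeq_le_of_lt_one hθ₀ hθ₁ T).trans ?_
  gcongr
  exact le_max_of_le_right (le_max_left _ _)

theorem psiSeq_tauSeq_le_growthConst (hθ : 1 < θ) (T : ℕ) : psiSeq (tauSeq θ) T ≤ growthConst θ :=
  (psiSeq_tauSeq_le_tsum hθ T).trans (le_max_of_le_right (le_max_right _ _))

theorem regretRate_tauSeq_le_of_lt_one (hθ₀ : 0 ≤ θ) (hθ₁ : θ < 1) (hP : 0 ≤ P) (hT : 1 ≤ T) :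
    regretRate κ (psiSeq (tauSeq θ) T) P T ≤
      2 * growthConst θ * ((T : ℝ) ^ max κ (1 - θ / 2) + (T : ℝ) ^ (θ / 2) * P) := by
  have hrate := regretRate_le_of_rpow_le (κ := κ) (one_le_growthConst θ)
    (rpow_le_psiSeq_tauSeq hθ₀ hT) (psiSeq_tauSeq_le_growthConst_mul_rpow hθ₀ hθ₁ T) hP
    (Nat.one_le_cast.2 hT)
  convert hrate using 5 <;> ring

theorem regretRate_tauSeq_le_of_one_lt (hθ : 1 < θ) (hP : 0 ≤ P) (hT : 1 ≤ T) :
    regretRate κ (psiSeq (tauSeq θ) T) P T ≤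
      2 * growthConst θ * ((T : ℝ) ^ max κ (1 / 2) + (T : ℝ) ^ (1 / 2 : ℝ) * P) := by
  have hτ := thresholdSequence_tauSeq (zero_le_one.trans hθ.le)
  simpa only [add_zero, sub_zero] using
    regretRate_le_of_rpow_le (κ := κ) (e := 0) (one_le_growthConst θ)
      (by simpa only [Real.rpow_zero] using hτ.one_le_psiSeq hT)
      (by simpa only [Real.rpow_zero, mul_one] using psiSeq_tauSeq_le_growthConst hθ T) hP
      (Nat.one_le_cast.2 hT)

theorem violationRate_tauSeq_le_of_lt_one (hθ₀ : 0 ≤ θ) (hθ₁ : θ < 1) (hT : 1 ≤ T) :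
    violationRate κ (psiSeq (tauSeq θ) T) T ≤
      2 * growthConst θ * (T : ℝ) ^ max (1 - κ / 2) (1 - θ / 4) := by
  have hτ := thresholdSequence_tauSeq hθ₀
  have hrate := violationRate_le_of_le_rpow (κ := κ) (one_le_growthConst θ)
    (zero_le_one.trans (hτ.one_le_psiSeq hT)) (psiSeq_tauSeq_le_growthConst_mul_rpow hθ₀ hθ₁ T)
    (Nat.one_le_cast.2 hT)
  convert hrate using 4
  ring

theorem violationRate_tauSeq_le_of_one_lt (hθ : 1 < θ) (hT : 1 ≤ T) :
    violationRate κ (psiSeq (tauSeq θ) T) T ≤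
      2 * growthConst θ * (T : ℝ) ^ max (1 - κ / 2) (3 / 4) := by
  have hτ := thresholdSequence_tauSeq (zero_le_one.trans hθ.le)
  simpa only [add_zero] using
    violationRate_le_of_le_rpow (κ := κ) (e := 0) (one_le_growthConst θ)
      (zero_le_one.trans (hτ.one_le_psiSeq hT))
      (by simpa only [Real.rpow_zero, mul_one] using psiSeq_tauSeq_le_growthConst hθ T)
      (Nat.one_le_cast.2 hT)

theorem regretRate_tauSeq_one_le (hP : 0 ≤ P) (hP₁ : T = 1 → P = 0) (hT : 1 ≤ T) :
    regretRate κ (psiSeq (tauSeq 1) T) P T ≤ 2 * growthConst 1 * regretRate κ (Real.log T) P T := by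
  have hthree : regretRate κ (psiSeq (tauSeq 1) T) P T ≤ 3 * regretRate κ (Real.log T) P T := by
    rcases hT.eq_or_lt with rfl | hT₂
    · norm_num [regretRate, hP₁, psiSeq, tauSeq]
    · exact regretRate_le_mul (by norm_num) (Real.log_pos (Nat.one_lt_cast.2 hT₂))
        (log_le_psiSeq_tauSeq_one hT) (psiSeq_tauSeq_one_le hT₂) hP T.cast_nonneg
  exact hthree.trans (mul_le_mul_of_nonneg_right (by linarith [three_le_growthConst 1])
    (regretRate_nonneg hP T.cast_nonneg))

theorem violationRate_tauSeq_one_le (hT : 1 ≤ T) :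
    violationRate κ (psiSeq (tauSeq 1) T) T ≤
      2 * growthConst 1 * violationRate κ (Real.log T) T := by
  have hlog : 0 ≤ Real.log T := Real.log_natCast_nonneg T
  have hthree : violationRate κ (psiSeq (tauSeq 1) T) T ≤ 3 * violationRate κ (Real.log T) T := by
    rcases hT.eq_or_lt with rfl | hT₂
    · norm_num [violationRate, psiSeq, tauSeq]
    · exact violationRate_le_mul (by norm_num) (hlog.trans (log_le_psiSeq_tauSeq_one hT)) hlog
        (psiSeq_tauSeq_one_le hT₂) T.cast_nonneg
  exact hthree.trans (mul_le_mul_of_nonneg_right (by linarith [three_le_growthConst 1])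
    (violationRate_nonneg hlog T.cast_nonneg))

end Rates

section Uniform

theorem exists_netReg_le_and_netCCV_le {n : ℕ} (hn : 0 < n) (m : Fin n → ℕ) {R F₁ F₂ w κ : ℝ}
    (hR : 0 ≤ R) (hF₁ : 0 ≤ F₁) (hF₂ : 0 ≤ F₂) (hw : 0 < w) (B : ℕ) (hκ₀ : 0 < κ) (hκ₁ : κ < 1) :
    ∃ K > 0, ∀ (p : ℕ) (X : Set (Vec p)) (f : Fin n → ℕ → Vec p → ℝ)
      (g : (i : Fin n) → ℕ → Vec p → Vec (m i)) (G : ℕ → Digraph (Fin n))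
      (W : ℕ → Matrix (Fin n) (Fin n) ℝ) (τ : ℕ → ℝ) (s : Trajectory n p m),
      ConvexProblem X f g R F₁ F₂ → MixingNetwork G W w B → ThresholdSequence τ →
      Generated X f g F₂ W (alphaSeq τ) (betaSeq κ) (gammaSeq κ) τ s → ∀ T : ℕ, 1 ≤ T →
        (∀ y ∈ feasibleSeqs X g T,
          netReg f s.x y T ≤ K * regretRate κ (psiSeq τ T) (pathLength y T) T) ∧
        ((feasibleStatic X g T).Nonempty →
          netCCV g s.x T ≤ K * violationRate κ (psiSeq τ T) T) := by
  have hC := rateConst_nonneg m B F₁ hw hR hF₂ hκ₀ hκ₁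
  have hnF : 0 ≤ n * F₁ := by positivity
  have hdiv : rateConst m B w R F₁ F₂ κ / n ≤ rateConst m B w R F₁ F₂ κ :=
    div_le_self hC (Nat.one_le_cast.2 hn)
  refine ⟨n * F₁ + 3 * rateConst m B w R F₁ F₂ κ + 1, by positivity,
    fun p X f g G W τ s hP hW hτ h T hT => ⟨fun y hy => ?_, fun hX => ?_⟩⟩
  · exact (h.netReg_le hP hW hτ hn hw hR hF₂ hκ₀ hκ₁ hT hy).trans (mul_le_mul_of_nonneg_right
      (by linarith) (regretRate_nonneg (pathLength_nonneg y T) T.cast_nonneg))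
  · exact (h.netCCV_le_violationRate hP hW hτ hn hw hR hF₁ hF₂ hκ₀ hκ₁ hT hX).trans
      (mul_le_mul_of_nonneg_right (by linarith) (violationRate_nonneg
        (zero_le_one.trans (hτ.one_le_psiSeq hT)) T.cast_nonneg))

end Uniform

end EventTriggered

open EventTriggered in
theorem corollary1
    (n : ℕ) (hn : 0 < n) (m : Fin n → ℕ)
    (R F₁ F₂ : ℝ) (hR : 0 < R) (hF₁ : 0 < F₁) (hF₂ : 0 < F₂)
    (w : ℝ) (hw0 : 0 < w) (hw1 : w < 1) (B : ℕ) (hB : 0 < B)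
    (κ : ℝ) (hκ0 : 0 < κ) (hκ1 : κ < 1) (θ : ℝ) (hθ : 0 < θ) :
    ∃ C : ℝ, 0 < C ∧
      ∀ (p : ℕ) (X : Set (EventTriggered.Vec p))
        (f : Fin n → ℕ → EventTriggered.Vec p → ℝ)
        (g : (i : Fin n) → ℕ → EventTriggered.Vec p → EventTriggered.Vec (m i))
        (G : ℕ → Digraph (Fin n)) (W : ℕ → Matrix (Fin n) (Fin n) ℝ)
        (s : EventTriggered.Trajectory n p m),
        EventTriggered.ConvexProblem X f g R F₁ F₂ →
        EventTriggered.MixingNetwork G W w B →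
        EventTriggered.Generated X f g F₂ W
          (EventTriggered.alphaSeq (EventTriggered.tauSeq θ))
          (EventTriggered.betaSeq κ) (EventTriggered.gammaSeq κ)
          (EventTriggered.tauSeq θ) s →
        ∀ T : ℕ, 1 ≤ T →
          -- network regret against every feasible comparator sequence
          (∀ y ∈ EventTriggered.feasibleSeqs X g T,
            (θ < 1 →
              EventTriggered.netReg f s.x y T ≤
                C * ((T : ℝ) ^ max κ (1 - θ / 2) +
                  (T : ℝ) ^ (θ / 2) * EventTriggered.pathLength y T)) ∧
            (θ = 1 →
              EventTriggered.netReg f s.x y T ≤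
                C * ((T : ℝ) ^ κ + √((T : ℝ) * Real.log T) +
                  √((T : ℝ) / Real.log T) * EventTriggered.pathLength y T)) ∧
            (1 < θ →
              EventTriggered.netReg f s.x y T ≤
                C * ((T : ℝ) ^ max κ (1 / 2) +
                  (T : ℝ) ^ (1 / 2 : ℝ) * EventTriggered.pathLength y T))) ∧
          -- network cumulative constraint violation
          ((EventTriggered.feasibleStatic X g T).Nonempty →
            (θ < 1 →
              EventTriggered.netCCV g s.x T ≤
                C * (T : ℝ) ^ max (1 - κ / 2) (1 - θ / 4)) ∧
            (θ = 1 →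
              EventTriggered.netCCV g s.x T ≤
                C * ((T : ℝ) ^ (1 - κ / 2) +
                  ((T : ℝ) ^ 3 * Real.log T) ^ (1 / 4 : ℝ))) ∧
            (1 < θ →
              EventTriggered.netCCV g s.x T ≤
                C * (T : ℝ) ^ max (1 - κ / 2) (3 / 4))) := by
  obtain ⟨K, hK, hbound⟩ :=
    exists_netReg_le_and_netCCV_le hn m hR.le hF₁.le hF₂.le hw0 B hκ0 hκ1
  have hgrowth : 0 < 2 * growthConst θ := by linarith [three_le_growthConst θ]
  have scale {a b : ℝ} (hab : a ≤ 2 * growthConst θ * b) : K * a ≤ K * (2 * growthConst θ) * b :=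
    (mul_le_mul_of_nonneg_left hab hK.le).trans_eq (mul_assoc _ _ _).symm
  refine ⟨K * (2 * growthConst θ), mul_pos hK hgrowth, fun p X f g G W s hP hW hs T hT => ?_⟩
  obtain ⟨hreg, hccv⟩ := hbound p X f g G W _ s hP hW (thresholdSequence_tauSeq hθ.le) hs T hT
  refine ⟨fun y hy => ?_, fun hX => ?_⟩
  · have hpath := pathLength_nonneg y T
    refine ⟨fun hθ₁ => (hreg y hy).trans (scale ?_), ?_, fun hθ₁ => (hreg y hy).trans (scale ?_)⟩
    · exact regretRate_tauSeq_le_of_lt_one hθ.le hθ₁ hpath hT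
    · rintro rfl
      exact (hreg y hy).trans (scale (regretRate_tauSeq_one_le hpath (by rintro rfl; rfl) hT))
    · exact regretRate_tauSeq_le_of_one_lt hθ₁ hpath hT
  · refine ⟨fun hθ₁ => (hccv hX).trans (scale ?_), ?_, fun hθ₁ => (hccv hX).trans (scale ?_)⟩
    · exact violationRate_tauSeq_le_of_lt_one hθ.le hθ₁ hT
    · rintro rfl
      exact (hccv hX).trans (scale (violationRate_tauSeq_one_le hT))
    · exact violationRate_tauSeq_le_of_one_lt hθ₁ hT
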